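/- \textbf{Theorem.} There are a single deterministic algorithm and an absolute constant $c$ with the following property. Let $R$ and $S$ be finite rings of the same order $n$, where a ring is associative but is not required to be commutative or to have an identity element. Suppose that the elements of each ring are numbered $0,\dots,n-1$ in an arbitrary way, and that the input consists of $n$ followed by the addition and multiplication tables of $R$ and of $S$ with respect to these numberings. Then the algorithm halts and correctly decides whether $R\cong S$. Moreover, if $n\ge 2$ and $p$ is the smallest prime dividing $n$, then its running time is at most $$n^{\frac12\log_p n + c}.$$ Here the running time is measured on a deterministic random access machine (with instructions for constants, addition, truncated subtraction, multiplication, integer division, indirect load and store, conditional branching and loops) under the logarithmic cost criterion: every executed instruction or test costs one plus the total number of binary digits of the numbers, including addresses, that it handles. -/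

import Mathlib

/-! ## A deterministic random access machine with logarithmic cost

A machine has registers and a random access memory, both holding natural numbers of arbitrary
size.  A program is one fixed finite text built from arithmetic instructions, indirect memory
access, sequencing, branching and loops.  Every executed instruction and every executed test
costs one plus the total bit length of the numbers it handles, addresses included. -/

namespace RAM

/-- The contents of the registers and of the memory cells. -/
structure State where
  reg : ℕ → ℕ
  mem : ℕ → ℕ

/-- Elementary instructions; `r`, `a`, `b` are indices of registers. -/
inductive Instr where
  /-- `reg r := k` -/
  | const (r k : ℕ)
  /-- `reg r := reg a + reg b` -/
  | add (r a b : ℕ)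
  /-- `reg r := max (reg a - reg b) 0` -/
  | sub (r a b : ℕ)
  /-- `reg r := reg a * reg b` -/
  | mul (r a b : ℕ)
  /-- `reg r := ⌊reg a / reg b⌋`, and `0` if `reg b = 0` -/
  | div (r a b : ℕ)
  /-- `reg r := mem (reg a)` -/
  | load (r a : ℕ)
  /-- `mem (reg a) := reg b` -/
  | store (a b : ℕ)

/-- Programs. -/
inductive Prog where
  | skip
  | instr (i : Instr)
  | seq (P Q : Prog)
  /-- If `reg r ≠ 0` then `P` else `Q`. -/
  | ifNZ (r : ℕ) (P Q : Prog)
  /-- While `reg r ≠ 0` do `P`. -/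
  | whileNZ (r : ℕ) (P : Prog)

/-- The state with the value of register `r` replaced by `v`. -/
def State.setReg (s : State) (r v : ℕ) : State :=
  ⟨Function.update s.reg r v, s.mem⟩

/-- The state with the content of memory cell `x` replaced by `v`. -/
def State.setMem (s : State) (x v : ℕ) : State :=
  ⟨s.reg, Function.update s.mem x v⟩

/-- The effect of an instruction. -/
def Instr.apply : Instr → State → State
  | .const r k, s => s.setReg r k
  | .add r a b, s => s.setReg r (s.reg a + s.reg b)
  | .sub r a b, s => s.setReg r (s.reg a - s.reg b)
  | .mul r a b, s => s.setReg r (s.reg a * s.reg b)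
  | .div r a b, s => s.setReg r (s.reg a / s.reg b)
  | .load r a, s => s.setReg r (s.mem (s.reg a))
  | .store a b, s => s.setMem (s.reg a) (s.reg b)

/-- The logarithmic cost of an instruction; `Nat.size k` is the number of binary digits of `k`. -/
def Instr.cost : Instr → State → ℕ
  | .const _ k, _ => 1 + k.size
  | .add _ a b, s => 1 + (s.reg a).size + (s.reg b).size
  | .sub _ a b, s => 1 + (s.reg a).size + (s.reg b).size
  | .mul _ a b, s => 1 + (s.reg a).size + (s.reg b).size
  | .div _ a b, s => 1 + (s.reg a).size + (s.reg b).size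
  | .load _ a, s => 1 + (s.reg a).size + (s.mem (s.reg a)).size
  | .store a b, s => 1 + (s.reg a).size + (s.reg b).size

/-- `Exec P s t s'`: started in state `s`, the program `P` halts after time exactly `t`
in state `s'`. -/
inductive Exec : Prog → State → ℕ → State → Prop where
  | skip (s : State) : Exec .skip s 1 s
  | instr (i : Instr) (s : State) : Exec (.instr i) s (i.cost s) (i.apply s)
  | seq {P Q : Prog} {s s' s'' : State} {t u : ℕ} :
      Exec P s t s' → Exec Q s' u s'' → Exec (.seq P Q) s (t + u) s''
  | ifTrue {r : ℕ} {P Q : Prog} {s s' : State} {t : ℕ} :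
      s.reg r ≠ 0 → Exec P s t s' → Exec (.ifNZ r P Q) s (1 + (s.reg r).size + t) s'
  | ifFalse {r : ℕ} {P Q : Prog} {s s' : State} {t : ℕ} :
      s.reg r = 0 → Exec Q s t s' → Exec (.ifNZ r P Q) s (1 + (s.reg r).size + t) s'
  | whileTrue {r : ℕ} {P : Prog} {s s' s'' : State} {t u : ℕ} :
      s.reg r ≠ 0 → Exec P s t s' → Exec (.whileNZ r P) s' u s'' →
      Exec (.whileNZ r P) s (1 + (s.reg r).size + t + u) s''
  | whileFalse {r : ℕ} {P : Prog} {s : State} :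
      s.reg r = 0 → Exec (.whileNZ r P) s (1 + (s.reg r).size) s

/-- The machine is deterministic: the halting time and the final state are unique. -/
theorem Exec.deterministic {P : Prog} {s s₁ s₂ : State} {t₁ t₂ : ℕ}
    (h₁ : Exec P s t₁ s₁) (h₂ : Exec P s t₂ s₂) : t₁ = t₂ ∧ s₁ = s₂ := by
  induction h₁ generalizing t₂ s₂ with
  | skip s => cases h₂; exact ⟨rfl, rfl⟩
  | instr i s => cases h₂; exact ⟨rfl, rfl⟩
  | seq _ _ ih₁ ih₂ =>
    cases h₂ with
    | seq a b =>
      obtain ⟨rfl, rfl⟩ := ih₁ a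
      obtain ⟨rfl, rfl⟩ := ih₂ b
      exact ⟨rfl, rfl⟩
  | ifTrue h _ ih =>
    cases h₂ with
    | ifTrue _ a => obtain ⟨rfl, rfl⟩ := ih a; exact ⟨rfl, rfl⟩
    | ifFalse h' _ => exact absurd h' h
  | ifFalse h _ ih =>
    cases h₂ with
    | ifTrue h' _ => exact absurd h h'
    | ifFalse _ a => obtain ⟨rfl, rfl⟩ := ih a; exact ⟨rfl, rfl⟩
  | whileTrue h _ _ ih₁ ih₂ =>
    cases h₂ with
    | whileTrue _ a b =>
      obtain ⟨rfl, rfl⟩ := ih₁ a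
      obtain ⟨rfl, rfl⟩ := ih₂ b
      exact ⟨rfl, rfl⟩
    | whileFalse h' => exact absurd h' h
  | whileFalse h =>
    cases h₂ with
    | whileTrue h' _ _ => exact absurd h h'
    | whileFalse _ => exact ⟨rfl, rfl⟩

/-- The initial state on the input word `w`: `w` is stored from memory cell `0` on, and all other
memory cells and all registers are `0`. -/
def init (w : List ℕ) : State :=
  ⟨fun _ => 0, fun x => w.getD x 0⟩

end RAM

/-- The table of a binary operation on a set whose elements are numbered `0, …, n - 1`, row by
row: the entry number `i * n + j` is the number of the result on elements `i` and `j`. -/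
def opTable {n : ℕ} {α : Type} (e : α ≃ Fin n) (op : α → α → α) : List ℕ :=
  List.ofFn fun k : Fin (n * n) => (e (op (e.symm k.divNat) (e.symm k.modNat)) : ℕ)

/-- The input word for a pair of finite rings of order `n`: the number `n`, the addition and
multiplication tables of `R`, then those of `S`. -/
def ringPairInput {n : ℕ} {R S : Type} [NonUnitalRing R] [NonUnitalRing S]
    (eR : R ≃ Fin n) (eS : S ≃ Fin n) : List ℕ :=
  n :: (opTable eR (· + ·) ++ opTable eR (· * ·) ++ opTable eS (· + ·) ++ opTable eS (· * ·))

/-! The algorithm is a meet-in-the-middle search over generating sequences of the additive groups.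
Adjoining an element outside a subgroup multiplies its order by a divisor of `n` other than 1, hence
by at least the smallest prime `p` (`minFac_mul_length_le`). Let `m` be least with `n ≤ p ^ (2 *
m)`. Then any rule that always picks a new element lists the whole group within `2 * m` steps,
starting from zero (`greedy_spec`).

A sequence of elements determines an ordered list of the subgroup it generates, by closing the list
under one translation after another. This construction commutes with isomorphisms. In `R` the first
`m` choices are greedy and the last `m` run over all `n ^ m` tuples; in `S` the first `m` run over
all tuples and the last `m` are greedy. Given `φ : R ≃+* S`, some tuple of `S` is the image of the
greedy half of `R`, and the greedy half of `S` that follows is the image of some tuple of `R`. So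
the families contain two complete lists that correspond under `φ`, and the operation tables written
in list positions coincide. Conversely, equal tables of complete lists give an isomorphism
(`nonempty_ringEquiv_iff_collision`). Thus `2 * n ^ m` lists suffice, although a full generating
sequence has about `2 * m` terms.

Each table is packed into one number, which serves as a memory address: the codes of `R` are marked
and those of `S` looked up. Such a number has polynomially many digits in `n`, so a single access
has polynomial logarithmic cost. The machine part is a small program logic: `Run` counts operations
in units proportional to the size of a bound `V` on all stored numbers, and each routine is shown to
simulate its model on lists. Finally `m ≤ (1 / 2) * log_p n + 1`, and the polynomial factors go into
`c`. -/

namespace RAM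

/-! ## Arithmetic expressions and their compilation -/

/-- Binary operations of the machine. -/
inductive BinOp where
  | add | sub | mul | div

/-- The value of a binary operation. -/
def BinOp.app : BinOp → ℕ → ℕ → ℕ
  | .add, a, b => a + b
  | .sub, a, b => a - b
  | .mul, a, b => a * b
  | .div, a, b => a / b

/-- The instruction performing a binary operation. -/
def BinOp.toInstr : BinOp → ℕ → ℕ → ℕ → Instr
  | .add => .add
  | .sub => .sub
  | .mul => .mul
  | .div => .div

/-- Arithmetic expressions over constants, registers and memory cells. -/
inductive Ex where
  | const (c : ℕ)
  | var (r : ℕ)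
  | op (o : BinOp) (a b : Ex)
  | load (a : Ex)

namespace Ex

instance : Add Ex := ⟨.op .add⟩
instance : Sub Ex := ⟨.op .sub⟩
instance : Mul Ex := ⟨.op .mul⟩
instance : Div Ex := ⟨.op .div⟩

/-- The value of an expression in a state. -/
def val : Ex → State → ℕ
  | const c, _ => c
  | var r, s => s.reg r
  | op o a b, s => o.app (a.val s) (b.val s)
  | load a, s => s.mem (a.val s)

@[simp] theorem val_const (c : ℕ) (s : State) : (const c).val s = c := rfl
@[simp] theorem val_var (r : ℕ) (s : State) : (var r).val s = s.reg r := rfl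
@[simp] theorem val_add (a b : Ex) (s : State) : (a + b).val s = a.val s + b.val s := rfl
@[simp] theorem val_sub (a b : Ex) (s : State) : (a - b).val s = a.val s - b.val s := rfl
@[simp] theorem val_mul (a b : Ex) (s : State) : (a * b).val s = a.val s * b.val s := rfl
@[simp] theorem val_div (a b : Ex) (s : State) : (a / b).val s = a.val s / b.val s := rfl
@[simp] theorem val_load (a : Ex) (s : State) : (load a).val s = s.mem (a.val s) := rfl

/-- The program that evaluates an expression into register `t`, using only registers from `t`
on. -/
def comp : Ex → ℕ → Prog
  | const c, t => .instr (.const t c)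
  | var r, t => .seq (.instr (.const t 0)) (.instr (.add t t r))
  | op o a b, t => .seq (a.comp t) (.seq (b.comp (t + 1)) (.instr (o.toInstr t t (t + 1))))
  | load a, t => .seq (a.comp t) (.instr (.load t t))

/-- A degree bounding the value of an expression polynomially. -/
def deg : Ex → ℕ
  | const _ => 1
  | var _ => 1
  | op _ a b => a.deg + b.deg
  | load _ => 1

/-- The cost of evaluating an expression, in units of the size of a bound on the state. -/
def weight : Ex → ℕ
  | const _ => 2
  | var _ => 3
  | op _ a b => a.weight + b.weight + 1 + a.deg + b.deg
  | load a => a.weight + 2 + a.deg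

/-- The expression uses only small constants and program variables. -/
def wf : Ex → Bool
  | const c => decide (c ≤ 8)
  | var r => decide (r < 32)
  | op _ a b => a.wf && b.wf
  | load a => a.wf

/-- The expression is well formed and cheap. -/
def good (e : Ex) : Bool := e.wf && decide (e.weight ≤ 190)

end Ex

/-- Agreement of two states on the program variables and on the memory. -/
def Agree (s σ : State) : Prop := (∀ r < 32, s.reg r = σ.reg r) ∧ s.mem = σ.mem

/-- All numbers in the program variables and in the memory are below `V`. -/
structure Bounded (V : ℕ) (σ : State) : Prop where
  large : 8 < V
  reg : ∀ r < 32, σ.reg r < V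
  mem : ∀ x, σ.mem x < V

namespace State

@[simp] theorem setReg_reg (s : State) (r v r' : ℕ) :
    (s.setReg r v).reg r' = if r' = r then v else s.reg r' := by
  simp [setReg, Function.update_apply]

@[simp] theorem setReg_mem (s : State) (r v : ℕ) : (s.setReg r v).mem = s.mem := rfl

@[simp] theorem setMem_reg (s : State) (x v : ℕ) : (s.setMem x v).reg = s.reg := rfl

@[simp] theorem setMem_mem (s : State) (x v y : ℕ) :
    (s.setMem x v).mem y = if y = x then v else s.mem y := by
  simp [setMem, Function.update_apply]

end State

theorem size_pow_le (V k : ℕ) (hk : 1 ≤ k) : (V ^ k).size ≤ k * V.size := by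
  rw [Nat.size_le, mul_comm, pow_mul]
  exact Nat.pow_lt_pow_left (Nat.lt_size_self V) (by omega)

theorem Ex.one_le_deg (e : Ex) : 1 ≤ e.deg := by
  induction e <;> simp [Ex.deg]; omega

theorem BinOp.app_lt {V i j a b : ℕ} (hV : 8 < V) (hi : 1 ≤ i) (hj : 1 ≤ j) (o : BinOp)
    (ha : a < V ^ i) (hb : b < V ^ j) : o.app a b < V ^ (i + j) := by
  -- Two numbers that are at least 2 have a sum not exceeding their product, which settles the case
  -- of addition.
  have h1 : 2 ≤ V ^ i := le_trans (by omega) (Nat.le_self_pow (by omega) V)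
  have h2 : 2 ≤ V ^ j := le_trans (by omega) (Nat.le_self_pow (by omega) V)
  have hij : V ^ i ≤ V ^ (i + j) := Nat.pow_le_pow_right (by omega) (by omega)
  cases o with
  | add => simp only [app]; rw [pow_add]; nlinarith
  | sub => exact lt_of_le_of_lt (Nat.sub_le _ _) (ha.trans_le hij)
  | mul => simp only [app]; rw [pow_add]; exact Nat.mul_lt_mul'' ha hb
  | div => exact lt_of_le_of_lt (Nat.div_le_self _ _) (ha.trans_le hij)

theorem Ex.deg_le_weight (e : Ex) : e.deg ≤ e.weight := by
  cases e <;> simp [Ex.deg, Ex.weight]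
  omega

/-- Intermediate values may exceed `V`, but only polynomially. A load brings the degree back to 1,
because memory contents, unlike addresses, are below `V`. -/
theorem Ex.val_lt {V : ℕ} {σ : State} (hB : Bounded V σ) (e : Ex) (he : e.wf = true) :
    e.val σ < V ^ e.deg := by
  induction e with
  | const c => simp [Ex.wf] at he; simp [Ex.deg]; have := hB.large; omega
  | var r => simp [Ex.wf] at he; simpa [Ex.deg] using hB.reg r he
  | op o a b iha ihb =>
    simp [Ex.wf] at he
    exact BinOp.app_lt hB.large a.one_le_deg b.one_le_deg o (iha he.1) (ihb he.2)
  | load a => simpa [Ex.deg] using hB.mem _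

theorem Ex.size_val_le {V : ℕ} {σ : State} (hB : Bounded V σ) (e : Ex) (he : e.wf = true) :
    (e.val σ).size ≤ e.deg * V.size :=
  (Nat.size_le_size (e.val_lt hB he).le).trans (size_pow_le V _ e.one_le_deg)

theorem Bounded.one_le_size {V : ℕ} {σ : State} (hB : Bounded V σ) : 1 ≤ V.size :=
  Nat.size_pos.2 (by have := hB.large; omega)

theorem BinOp.apply_toInstr (o : BinOp) (r a b : ℕ) (s : State) :
    (o.toInstr r a b).apply s = s.setReg r (o.app (s.reg a) (s.reg b)) := by
  cases o <;> rfl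

theorem BinOp.cost_toInstr (o : BinOp) (r a b : ℕ) (s : State) :
    (o.toInstr r a b).cost s = 1 + (s.reg a).size + (s.reg b).size := by
  cases o <;> rfl

/-- The registers from `t` on act as an evaluation stack: the second operand is computed from `t +
1` on and leaves the first one, in `t`, intact. As `t ≥ 32`, program variables are never
overwritten. -/
theorem Ex.exec_comp {V : ℕ} {σ : State} (hB : Bounded V σ) (e : Ex) :
    ∀ (s : State) (t : ℕ), Agree s σ → e.wf = true → 32 ≤ t →
      ∃ c s', Exec (e.comp t) s c s' ∧ c ≤ e.weight * V.size ∧ s'.reg t = e.val σ ∧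
        (∀ r < t, s'.reg r = s.reg r) ∧ s'.mem = s.mem := by
  have hV := hB.one_le_size
  induction e with
  | const c =>
    intro s t hs he ht
    refine ⟨_, _, .instr _ _, ?_, ?_, ?_, ?_⟩
    · have := (Ex.const c).size_val_le hB he
      simp only [Ex.val_const, Ex.deg] at this
      simp only [Instr.cost, Ex.weight]; omega
    · simp [Instr.apply]
    · intro r hr; simp [Instr.apply, hr.ne]
    · simp [Instr.apply]
  | var r =>
    intro s t hs he ht
    simp [Ex.wf] at he
    refine ⟨_, _, .seq (.instr _ _) (.instr _ _), ?_, ?_, ?_, ?_⟩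
    · have h := (Ex.var r).size_val_le hB (by simpa [Ex.wf] using he)
      simp only [Ex.val_var, Ex.deg] at h
      have hr : r ≠ t := by omega
      simp [Instr.cost, Instr.apply, Ex.weight, hr, hs.1 r he]; omega
    · have hr : r ≠ t := by omega
      simp [Instr.apply, hr, hs.1 r he]
    · intro r hr; simp [Instr.apply, hr.ne]
    · simp [Instr.apply]
  | op o a b iha ihb =>
    intro s t hs he ht
    simp [Ex.wf] at he
    obtain ⟨c₁, s₁, e₁, h₁, v₁, f₁, m₁⟩ := iha s t hs he.1 ht
    have hs₁ : Agree s₁ σ :=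
      ⟨fun r hr => (f₁ r (by omega)).trans (hs.1 r hr), m₁.trans hs.2⟩
    obtain ⟨c₂, s₂, e₂, h₂, v₂, f₂, m₂⟩ := ihb s₁ (t + 1) hs₁ he.2 (by omega)
    refine ⟨_, _, .seq e₁ (.seq e₂ (.instr _ _)), ?_, ?_, ?_, ?_⟩
    · have := a.size_val_le hB he.1
      have := b.size_val_le hB he.2
      rw [BinOp.cost_toInstr, f₂ t (by omega), v₁, v₂]
      simp only [Ex.weight, add_mul, one_mul]; omega
    · rw [BinOp.apply_toInstr]; simp [f₂ t (by omega), v₁, v₂, Ex.val]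
    · intro r hr
      rw [BinOp.apply_toInstr]; simp [hr.ne, f₂ r (by omega), f₁ r hr]
    · rw [BinOp.apply_toInstr]; simp [m₁, m₂]
  | load a iha =>
    intro s t hs he ht
    obtain ⟨c₁, s₁, e₁, h₁, v₁, f₁, m₁⟩ := iha s t hs he ht
    refine ⟨_, _, .seq e₁ (.instr _ _), ?_, ?_, ?_, ?_⟩
    · have := a.size_val_le hB he
      have h := (Ex.load a).size_val_le hB he
      simp only [Ex.val_load, Ex.deg] at h
      simp only [Instr.cost, v₁, m₁, hs.2, Ex.weight, add_mul]; omega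
    · simp [Instr.apply, v₁, m₁, hs.2]
    · intro r hr; simp [Instr.apply, hr.ne, f₁ r hr]
    · simp [Instr.apply, m₁]

/-! ## Statements and rules for reasoning about them -/

/-- Assign the value of `e` to the variable `r`. -/
def asg (r : ℕ) (e : Ex) : Prog :=
  .seq (e.comp 32) (.seq (.instr (.const r 0)) (.instr (.add r r 32)))

/-- Store the value of `b` in the memory cell with address `a`. -/
def sto (a b : Ex) : Prog :=
  .seq (a.comp 32) (.seq (b.comp 33) (.instr (.store 32 33)))

/-- Branch on whether the value of `e` is nonzero. -/
def ite (e : Ex) (P Q : Prog) : Prog := .seq (e.comp 32) (.ifNZ 32 P Q)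

/-- From every state that agrees with `σ`, the program `P` halts within `N` units of time in a
state that agrees with one satisfying `Q`; all numbers stay below `V`. -/
def Run (V : ℕ) (P : Prog) (σ : State) (N : ℕ) (Q : State → Prop) : Prop :=
  Bounded V σ → ∀ s, Agree s σ →
    ∃ t s' σ', Exec P s t s' ∧ Agree s' σ' ∧ t ≤ N * (200 * V.size) ∧ Bounded V σ' ∧ Q σ'

section Rules

variable {V N N' r : ℕ} {σ : State} {P P' : Prog} {e a b : Ex} {Q Q' : State → Prop}

theorem Run.mono (h : Run V P σ N Q) (hN : N ≤ N') (hQ : ∀ σ', Q σ' → Q' σ') :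
    Run V P σ N' Q' := by
  intro hB s hs
  obtain ⟨t, s', σ', h1, h2, h3, h4, h5⟩ := h hB s hs
  exact ⟨t, s', σ', h1, h2, h3.trans (Nat.mul_le_mul_right _ hN), h4, hQ _ h5⟩

theorem Run.skip (h : Q σ) : Run V .skip σ 1 Q := fun hB s hs =>
  ⟨_, _, σ, .skip s, hs, by have := hB.one_le_size; omega, hB, h⟩

theorem Run.seq (h : Run V P σ N Q) (h' : ∀ σ', Q σ' → Run V P' σ' N' Q') :
    Run V (.seq P P') σ (N + N') Q' := by
  intro hB s hs
  obtain ⟨t, s', σ', h1, h2, h3, h4, h5⟩ := h hB s hs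
  obtain ⟨t', s'', σ'', k1, k2, k3, k4, k5⟩ := h' σ' h5 h4 s' h2
  exact ⟨_, s'', σ'', .seq h1 k1, k2, by rw [add_mul]; omega, k4, k5⟩

/-- Evaluating a good expression costs at most `190 * V.size`; the two instructions that move the
result fit into the rest of the unit `200 * V.size`. -/
theorem Run.asg (he : e.good = true) (hr : r < 32) (hv : e.val σ < V)
    (hQ : Q (σ.setReg r (e.val σ))) : Run V (asg r e) σ 1 Q := by
  intro hB s hs
  simp only [Ex.good, Bool.and_eq_true, decide_eq_true_eq] at he
  obtain ⟨c, s', h1, h2, h3, h4, h5⟩ := e.exec_comp hB s 32 hs he.1 le_rfl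
  have hV := hB.one_le_size
  refine ⟨_, _, _, .seq h1 (.seq (.instr _ _) (.instr _ _)), ⟨?_, ?_⟩, ?_, ⟨hB.large, ?_, ?_⟩, hQ⟩
  · intro r' hr'
    by_cases h : r' = r
    · simp [h, Instr.apply, h3, hr.ne']
    · simp [h, Instr.apply, h4 r' hr', hs.1 r' hr']
  · simp [Instr.apply, h5, hs.2]
  · have h6 : (e.val σ).size ≤ V.size := Nat.size_le_size hv.le
    have := Nat.mul_le_mul_right V.size he.2
    simp [Instr.apply, Instr.cost, h3, hr.ne']; omega
  · intro r' hr'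
    by_cases h : r' = r
    · simp [h, hv]
    · simp [h, hB.reg r' hr']
  · simpa using hB.mem

theorem Run.asg_seq (he : e.good = true) (hr : r < 32) (hv : e.val σ < V)
    (h : Run V P (σ.setReg r (e.val σ)) N Q) : Run V (.seq (RAM.asg r e) P) σ (1 + N) Q :=
  Run.seq (Q := fun σ' => σ' = σ.setReg r (e.val σ)) (.asg he hr hv rfl) (by rintro _ rfl; exact h)

/-- Only the stored value has to be below `V`. The address may be larger, since its size is
controlled by the degree of `a`; this permits codes to be used as addresses. -/
theorem Run.sto (ha : a.good = true) (hb : b.good = true) (hv : b.val σ < V)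
    (hQ : Q (σ.setMem (a.val σ) (b.val σ))) : Run V (sto a b) σ 4 Q := by
  intro hB s hs
  simp only [Ex.good, Bool.and_eq_true, decide_eq_true_eq] at ha hb
  obtain ⟨c, s', h1, h2, h3, h4, h5⟩ := a.exec_comp hB s 32 hs ha.1 le_rfl
  have hs' : Agree s' σ := ⟨fun r hr => (h4 r hr).trans (hs.1 r hr), h5.trans hs.2⟩
  obtain ⟨c', s'', k1, k2, k3, k4, k5⟩ := b.exec_comp hB s' 33 hs' hb.1 (by omega)
  have hV := hB.one_le_size
  refine ⟨_, _, _, .seq h1 (.seq k1 (.instr _ _)), ⟨?_, ?_⟩, ?_, ⟨hB.large, ?_, ?_⟩, hQ⟩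
  · intro r' hr'
    simp [Instr.apply, k4 r' (by omega), h4 r' hr', hs.1 r' hr']
  · simp [Instr.apply, State.setMem, k5, h5, hs.2, k3, k4 32 (by omega), h3]
  · have h6 : (b.val σ).size ≤ V.size := Nat.size_le_size hv.le
    have h7 := a.size_val_le hB ha.1
    have := Nat.mul_le_mul_right V.size ha.2
    have := Nat.mul_le_mul_right V.size hb.2
    have := Nat.mul_le_mul_right V.size a.deg_le_weight
    simp only [Instr.cost, k3, k4 32 (by omega), h3]
    omega
  · intro r' hr'; simpa using hB.reg r' hr'
  · intro x
    rw [State.setMem_mem]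
    split_ifs
    exacts [hv, hB.mem x]

theorem Run.sto_seq (ha : a.good = true) (hb : b.good = true) (hv : b.val σ < V)
    (h : Run V P (σ.setMem (a.val σ) (b.val σ)) N Q) : Run V (.seq (RAM.sto a b) P) σ (4 + N) Q :=
  Run.seq (Q := fun σ' => σ' = σ.setMem (a.val σ) (b.val σ)) (.sto ha hb hv rfl)
    (by rintro _ rfl; exact h)

theorem Run.ite (he : e.good = true) (h : e.val σ ≠ 0 → Run V P σ N Q)
    (h' : e.val σ = 0 → Run V P' σ N Q) : Run V (ite e P P') σ (2 + N) Q := by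
  intro hB s hs
  simp only [Ex.good, Bool.and_eq_true, decide_eq_true_eq] at he
  obtain ⟨c, s', h1, h2, h3, h4, h5⟩ := e.exec_comp hB s 32 hs he.1 le_rfl
  have hs' : Agree s' σ := ⟨fun r hr => (h4 r hr).trans (hs.1 r hr), h5.trans hs.2⟩
  have hV := hB.one_le_size
  have h7 := e.size_val_le hB he.1
  have := Nat.mul_le_mul_right V.size he.2
  have := Nat.mul_le_mul_right V.size e.deg_le_weight
  by_cases hv : e.val σ = 0
  · obtain ⟨t, s'', σ', k1, k2, k3, k4, k5⟩ := h' hv hB s' hs'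
    refine ⟨_, s'', σ', .seq h1 (.ifFalse (h3.trans hv) k1), k2, ?_, k4, k5⟩
    rw [h3, add_mul]; omega
  · obtain ⟨t, s'', σ', k1, k2, k3, k4, k5⟩ := h hv hB s' hs'
    refine ⟨_, s'', σ', .seq h1 (.ifTrue (h3.trans_ne hv) k1), k2, ?_, k4, k5⟩
    rw [h3, add_mul]; omega

/-- The invariant is indexed by the number of rounds still to come, which is the content of the
controlling register; termination and the time bound follow by induction on it. -/
theorem Run.loop {I : ℕ → State → Prop} (hr : r < 32)
    (h : ∀ k σ, I (k + 1) σ → σ.reg r = k + 1 → Run V P σ N fun σ' => σ'.reg r = k ∧ I k σ') :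
    ∀ k σ, I k σ → σ.reg r = k →
      Run V (.whileNZ r P) σ (k * (N + 1) + 1) fun σ' => σ'.reg r = 0 ∧ I 0 σ' := by
  intro k
  induction k with
  | zero =>
    intro σ hI hk hB s hs
    have hV := hB.one_le_size
    refine ⟨_, s, σ, .whileFalse ((hs.1 r hr).trans hk), hs, ?_, hB, hk, hI⟩
    simp [hs.1 r hr, hk]; omega
  | succ k ih =>
    intro σ hI hk hB s hs
    have hV := hB.one_le_size
    obtain ⟨t, s', σ', h1, h2, h3, h4, h5, h6⟩ := h k σ hI hk hB s hs
    obtain ⟨t', s'', σ'', k1, k2, k3, k4, k5⟩ := ih σ' h6 h5 h4 s' h2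
    refine ⟨_, s'', σ'', .whileTrue (by rw [hs.1 r hr, hk]; omega) h1 k1, k2, ?_, k4, k5⟩
    have h7 : (s.reg r).size ≤ V.size := by
      rw [hs.1 r hr]; exact Nat.size_le_size (hB.reg r hr).le
    calc 1 + (s.reg r).size + t + t'
        ≤ 200 * V.size + N * (200 * V.size) + (k * (N + 1) + 1) * (200 * V.size) := by omega
      _ = _ := by ring

end Rules

end RAM

namespace ListClosure

/-! ## Labelling the elements of a finite additive group by a generating sequence -/

section Lists

variable {R : Type} [DecidableEq R]

/-- Append an element to a list unless it is there already. -/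
def push (l : List R) (y : R) : List R := if y ∈ l then l else l ++ [y]

/-- The position of an element in a list, counted from `1`, and `0` for a missing element. -/
def label (l : List R) (r : R) : ℕ := if r ∈ l then l.idxOf r + 1 else 0

theorem subset_push (l : List R) (y : R) : l ⊆ push l y := by
  unfold push; split_ifs <;> simp

theorem mem_push (l : List R) (y : R) : y ∈ push l y := by
  unfold push; split_ifs with h <;> simp [h]

theorem eq_or_mem_of_mem_push {l : List R} {y a : R} (h : a ∈ push l y) : a = y ∨ a ∈ l := by
  unfold push at h; split_ifs at h
  · exact .inr h
  · simpa [or_comm] using h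

theorem nodup_push {l : List R} (hl : l.Nodup) (y : R) : (push l y).Nodup := by
  unfold push; split_ifs with h
  · exact hl
  · exact hl.append (List.nodup_singleton y) (by simpa using h)

theorem getElem?_push {l : List R} {y : R} {i : ℕ} (hi : i < l.length) :
    (push l y)[i]? = l[i]? := by
  unfold push; split_ifs
  · rfl
  · exact List.getElem?_append_left hi

theorem label_le (l : List R) (r : R) : label l r ≤ l.length := by
  unfold label
  split_ifs with h
  · exact List.idxOf_lt_length_of_mem h
  · omega

theorem label_eq_zero {l : List R} {r : R} : label l r = 0 ↔ r ∉ l := by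
  simp [label]

theorem label_getElem {l : List R} (hl : l.Nodup) {i : ℕ} (hi : i < l.length) :
    label l l[i] = i + 1 := by
  simp [label, hl.idxOf_getElem]

theorem eq_of_label_eq {l : List R} {r s : R} (hr : r ∈ l) (hs : s ∈ l)
    (h : label l r = label l s) : r = s := by
  simp only [label, hr, hs, if_true, add_left_inj] at h
  exact (List.idxOf_inj hr).1 h

theorem label_append_self {l : List R} {y : R} (hy : y ∉ l) :
    label (l ++ [y]) y = l.length + 1 := by
  simp [label, List.idxOf_append, hy]

theorem label_append_of_ne {l : List R} {y r : R} (hr : r ≠ y) :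
    label (l ++ [y]) r = label l r := by
  simp only [label, List.mem_append, List.mem_singleton, hr, or_false, List.idxOf_append]
  split_ifs <;> rfl

end Lists

section Defs

variable {R : Type} [AddCommGroup R] [DecidableEq R]

/-- Process the entry number `j` of a list: append its translate by `x`. -/
def step (x : R) (a : List R × ℕ) : List R × ℕ :=
  match a.1[a.2]? with
  | some y => (push a.1 (y + x), a.2 + 1)
  | none => a

/-- Close a list of at most `n` elements under translation by `x`. -/
def extend (n : ℕ) (x : R) (l : List R) : List R := ((step x)^[n] (l, 0)).1

/-- The list enumerates the subgroup. -/
def Enumerates (l : List R) (H : AddSubgroup R) : Prop := l.Nodup ∧ ∀ a, a ∈ l ↔ a ∈ H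

end Defs

/-! ### Closure under translation and growth of the generated subgroups -/

section Closure

variable {R : Type} [AddCommGroup R] [DecidableEq R]

/-- What holds after `k` steps of the closure of `l` under translation by `x`. -/
structure Partial (x : R) (l : List R) (k : ℕ) (a : List R × ℕ) : Prop where
  nodup : a.1.Nodup
  subset : l ⊆ a.1
  progress : a.2 = k ∨ a.1.length ≤ a.2
  closed : ∀ i < a.2, ∀ y, a.1[i]? = some y → y + x ∈ a.1
  sound : ∀ y ∈ a.1, ∃ b ∈ l, ∃ t : ℕ, y = b + t • x

theorem partial_step {x : R} {l : List R} {k : ℕ} {a : List R × ℕ} (h : Partial x l k a) :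
    Partial x l (k + 1) (step x a) := by
  obtain ⟨l', j⟩ := a
  unfold step
  cases hj : l'[j]? with
  | none =>
    simp only
    exact ⟨h.nodup, h.subset, .inr (by simpa using hj), h.closed, h.sound⟩
  | some y =>
    simp only
    obtain ⟨hj', rfl⟩ := List.getElem?_eq_some_iff.1 hj
    -- The position is still inside the list, so no earlier step has stalled.
    have h1 : j = k := h.progress.resolve_right (by simpa using hj')
    refine ⟨nodup_push h.nodup _, fun z hz => subset_push _ _ (h.subset hz),
      .inl (by simp [h1]), ?_, ?_⟩
    · intro i hi z hz
      simp only at hi hz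
      rw [getElem?_push (by omega)] at hz
      rcases Nat.lt_succ_iff_lt_or_eq.1 hi with hi | rfl
      · exact subset_push _ _ (h.closed i hi z hz)
      · rw [hj] at hz; cases hz; exact mem_push _ _
    · intro z hz
      rcases eq_or_mem_of_mem_push hz with rfl | hz
      · obtain ⟨b, hb, t, ht⟩ := h.sound _ (List.getElem_mem hj')
        exact ⟨b, hb, t + 1, by rw [ht, add_smul, one_smul, add_assoc]⟩
      · exact h.sound z hz

theorem partial_iterate {x : R} {l : List R} (hl : l.Nodup) (k : ℕ) :
    Partial x l k ((step x)^[k] (l, 0)) := by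
  induction k with
  | zero =>
    exact ⟨hl, fun _ h => h, .inl rfl, by simp, fun y hy => ⟨y, hy, 0, by simp⟩⟩
  | succ k ih => rw [Function.iterate_succ_apply']; exact partial_step ih

/-- In a finite group the multiples `t • x` with `t : ℕ` already form the cyclic subgroup of `x`. A
list that contains `H` and is closed under adding `x` therefore contains the whole join, and every
entry has the form `b + t • x` with `b ∈ H`. -/
theorem enumerates_extend [Finite R] {n : ℕ} (hn : n = Nat.card R) {l : List R}
    {H : AddSubgroup R} (h : Enumerates l H) (x : R) :
    Enumerates (extend n x l) (H ⊔ AddSubgroup.zmultiples x) := by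
  have := Fintype.ofFinite R
  have hp := partial_iterate (x := x) h.1 n
  -- All entries have been processed: either the position moved in each of the `n` steps, and a list
  -- without repetitions has at most `n` entries, or it ran past the end.
  have hlen : (extend n x l).length ≤ ((step x)^[n] (l, 0)).2 := by
    rcases hp.progress with h1 | h1
    · have h2 := List.Nodup.length_le_card hp.nodup
      rw [← Nat.card_eq_fintype_card, ← hn] at h2
      rwa [h1]
    · exact h1
  have hcl : ∀ y ∈ extend n x l, y + x ∈ extend n x l := by
    intro y hy
    obtain ⟨i, hi, rfl⟩ := List.getElem_of_mem hy
    exact hp.closed i (hi.trans_le hlen) _ (List.getElem?_eq_getElem hi)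
  refine ⟨hp.nodup, fun a => ⟨fun ha => ?_, fun ha => ?_⟩⟩
  · obtain ⟨b, hb, t, rfl⟩ := hp.sound a ha
    exact add_mem (AddSubgroup.mem_sup_left ((h.2 b).1 hb))
      (AddSubgroup.mem_sup_right (nsmul_mem (AddSubgroup.mem_zmultiples x) t))
  · obtain ⟨b, hb, c, hc, rfl⟩ := AddSubgroup.mem_sup.1 ha
    obtain ⟨t, rfl⟩ := mem_multiples_iff_mem_zmultiples.2 hc
    have h0 : b ∈ extend n x l := hp.subset ((h.2 b).2 hb)
    clear ha hc
    change b + t • x ∈ extend n x l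
    induction t with
    | zero => simpa using h0
    | succ t ih => rw [add_smul, one_smul, ← add_assoc]; exact hcl _ ih

theorem nodup_extend {n : ℕ} {l : List R} (hl : l.Nodup) (x : R) : (extend n x l).Nodup :=
  (partial_iterate hl n).nodup

theorem Enumerates.length {l : List R} {H : AddSubgroup R} (h : Enumerates l H) :
    l.length = Nat.card H := by
  rw [← List.toFinset_card_of_nodup h.1, ← Nat.card_eq_finsetCard]
  exact Nat.card_congr (Equiv.subtypeEquivRight fun a => by simpa using h.2 a)

theorem enumerates_zero (A : Type) [AddCommGroup A] : Enumerates [(0 : A)] ⊥ := by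
  simp [Enumerates]

/-- Extending by a new element multiplies the length by at least the smallest prime factor. -/
theorem minFac_mul_length_le [Finite R] {n : ℕ} (hn : n = Nat.card R) {l : List R}
    {H : AddSubgroup R} (h : Enumerates l H) {x : R} (hx : x ∉ l) :
    n.minFac * l.length ≤ (extend n x l).length := by
  have h' := enumerates_extend hn h x
  rw [h.length, h'.length]
  set K := H ⊔ AddSubgroup.zmultiples x
  have hHK : H ≤ K := le_sup_left
  -- The index `d` of `H` in `K` divides `n` by Lagrange and is not 1, so it is at least the
  -- smallest prime factor.
  obtain ⟨d, hd⟩ := AddSubgroup.card_dvd_of_le hHK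
  have hd0 : d ≠ 0 := by
    rintro rfl
    have : 0 < Nat.card K := Nat.card_pos
    omega
  have hd1 : d ≠ 1 := by
    rintro rfl
    have h1 : H = K := AddSubgroup.eq_of_le_of_card_ge hHK (by omega)
    exact hx ((h.2 x).2 (h1 ▸ AddSubgroup.mem_sup_right (AddSubgroup.mem_zmultiples x)))
  have hdn : d ∣ n := (Dvd.intro_left _ hd.symm).trans (hn ▸ AddSubgroup.card_addSubgroup_dvd_card K)
  rw [hd, mul_comm]
  exact Nat.mul_le_mul_left _ (Nat.minFac_le_of_dvd (by omega) hdn)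

/-- Extend a list `m` times by elements chosen by `g`. -/
def greedy (n : ℕ) (g : List R → R) (m : ℕ) (l : List R) : List R :=
  (fun l => extend n (g l) l)^[m] l

/-- A rule that chooses a new element as long as there is one. -/
def Chooses (g : List R → R) : Prop := ∀ l : List R, (∃ r, r ∉ l) → g l ∉ l

/-- Each step gains a factor of at least `n.minFac` as long as something is missing; once the list
is complete, it remains so. The starting subgroup is arbitrary because the greedy half for the
second ring begins with a list that tuples have produced. -/
theorem greedy_spec [Finite R] {n : ℕ} (hn : n = Nat.card R) {g : List R → R} (hg : Chooses g)
    (m : ℕ) {l : List R} {H : AddSubgroup R} (h : Enumerates l H) :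
    ∃ K, Enumerates (greedy n g m l) K ∧
      ((greedy n g m l).length = n ∨ n.minFac ^ m * l.length ≤ (greedy n g m l).length) := by
  induction m with
  | zero => exact ⟨H, h, by simp [greedy]⟩
  | succ m ih =>
    obtain ⟨K, hK, hlen⟩ := ih
    set l' := greedy n g m l with hl'
    have h1 : greedy n g (m + 1) l = extend n (g l') l' := Function.iterate_succ_apply' _ _ _
    rw [h1]
    refine ⟨_, enumerates_extend hn hK _, ?_⟩
    by_cases hall : ∃ r, r ∉ l'
    · right
      have h2 := minFac_mul_length_le hn hK (hg l' hall)
      rcases hlen with h3 | h3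
      · exfalso
        obtain ⟨r, hr⟩ := hall
        have h4 : K = ⊤ := AddSubgroup.eq_top_of_card_eq _ (by rw [← hK.length, h3, hn])
        exact hr ((hK.2 r).2 (h4 ▸ AddSubgroup.mem_top r))
      · calc n.minFac ^ (m + 1) * l.length = n.minFac * (n.minFac ^ m * l.length) := by ring
          _ ≤ n.minFac * l'.length := Nat.mul_le_mul_left _ h3
          _ ≤ _ := h2
    · left
      push Not at hall
      have h4 : K = ⊤ := (AddSubgroup.eq_top_iff' K).2 fun r => (hK.2 r).1 (hall r)
      have h5 := (enumerates_extend hn hK (g l')).length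
      rw [h4, top_sup_eq] at h5
      rw [h5, hn]; simp

end Closure

/-! ### Compatibility of the closure with isomorphisms; tuples as digit expansions -/

section Naturality

variable {R S : Type} [AddCommGroup R] [DecidableEq R] [AddCommGroup S] [DecidableEq S]
  (φ : R ≃+ S)

theorem map_push (l : List R) (y : R) : push (l.map φ) (φ y) = (push l y).map φ := by
  unfold push
  simp only [List.mem_map, EmbeddingLike.apply_eq_iff_eq, exists_eq_right]
  split_ifs <;> simp

theorem map_step (x : R) (l : List R) (j : ℕ) :
    step (φ x) (l.map φ, j) = ((step x (l, j)).1.map φ, (step x (l, j)).2) := by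
  unfold step
  simp only [List.getElem?_map]
  cases l[j]? with
  | none => rfl
  | some y => simp [← map_add, map_push]

/-- The closure looks only at sums and at equality of elements, and both are preserved by `φ`. -/
theorem map_extend (n : ℕ) (x : R) (l : List R) :
    extend n (φ x) (l.map φ) = (extend n x l).map φ := by
  have h : ∀ k, (step (φ x))^[k] (l.map φ, 0) =
      (((step x)^[k] (l, 0)).1.map φ, ((step x)^[k] (l, 0)).2) := by
    intro k
    induction k with
    | zero => rfl
    | succ k ih => rw [Function.iterate_succ_apply', ih, map_step, Function.iterate_succ_apply']
  simp [extend, h]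

theorem label_map (l : List R) (r : R) : label (l.map φ) (φ r) = label l r := by
  have h : (l.map φ).idxOf (φ r) = l.idxOf r := by
    induction l with
    | nil => rfl
    | cons a l ih => simp [List.idxOf_cons, ih, Bool.beq_eq_decide_eq, EmbeddingLike.apply_eq_iff_eq]
  simp [label, h]

/-- Extend a list by the elements of another list, one after the other. -/
def extendAll (n : ℕ) (l xs : List R) : List R := xs.foldl (fun l x => extend n x l) l

theorem map_extendAll (n : ℕ) (l xs : List R) :
    extendAll n (l.map φ) (xs.map φ) = (extendAll n l xs).map φ := by
  induction xs generalizing l with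
  | nil => rfl
  | cons x xs ih =>
    simp only [extendAll, List.map_cons, List.foldl_cons] at ih ⊢
    rw [map_extend, ih]

/-- The greedy rule depends on the numbering and is not preserved by isomorphisms. Recording its
choices as a sequence makes them transportable. -/
theorem greedy_eq_extendAll (n : ℕ) (g : List R → R) (m : ℕ) (l : List R) :
    ∃ xs : List R, xs.length = m ∧ greedy n g m l = extendAll n l xs := by
  induction m generalizing l with
  | zero => exact ⟨[], rfl, rfl⟩
  | succ m ih =>
    obtain ⟨xs, h1, h2⟩ := ih (extend n (g l) l)
    refine ⟨g l :: xs, by simp [h1], ?_⟩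
    rw [greedy, Function.iterate_succ_apply]
    exact h2

/-- Extend a list by the elements whose numbers are the lowest `m` digits of `T` in base `n`. -/
def byDigits (n : ℕ) (d : ℕ → R) : ℕ → ℕ → List R → List R
  | 0, _, l => l
  | m + 1, T, l => byDigits n d m (T / n) (extend n (d (T % n)) l)

theorem exists_byDigits {n : ℕ} {d : ℕ → R} (hd : ∀ r, ∃ i < n, d i = r) (xs l : List R) :
    ∃ T < n ^ xs.length, byDigits n d xs.length T l = extendAll n l xs := by
  induction xs generalizing l with
  | nil => exact ⟨0, by simp, rfl⟩
  | cons x xs ih =>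
    obtain ⟨i, hi, rfl⟩ := hd x
    obtain ⟨T, hT, h⟩ := ih (extend n (d i) l)
    -- The lowest digit is the element that is used first.
    refine ⟨i + n * T, ?_, ?_⟩
    · rw [List.length_cons, pow_succ']
      calc i + n * T < n * (T + 1) := by rw [mul_add]; omega
        _ ≤ _ := Nat.mul_le_mul_left _ hT
    · have hn : 0 < n := by omega
      simp only [List.length_cons, byDigits, extendAll, List.foldl_cons]
      rw [Nat.add_mul_mod_self_left, Nat.mod_eq_of_lt hi, Nat.add_mul_div_left _ _ hn,
        Nat.div_eq_of_lt hi, zero_add]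
      exact h

end Naturality

/-! ### Packing the operation tables into one number -/

section Code

variable {R S : Type} [NonUnitalRing R] [DecidableEq R] [NonUnitalRing S] [DecidableEq S]

/-- The entries number `k` of both operation tables with respect to the labels. -/
def cell (n : ℕ) (l : List R) (k : ℕ) : ℕ :=
  label l (l.getD (k / n) 0 + l.getD (k % n) 0) * (n + 1) +
    label l (l.getD (k / n) 0 * l.getD (k % n) 0)

/-- The code of a ring with respect to a list of its elements. -/
def code (n : ℕ) (l : List R) : ℕ :=
  Nat.ofDigits ((n + 1) ^ 2) ((List.range (n * n)).map (cell n l))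

theorem cell_lt {n : ℕ} {l : List R} (hl : l.length ≤ n) (k : ℕ) : cell n l k < (n + 1) ^ 2 := by
  have h1 := (label_le l (l.getD (k / n) 0 + l.getD (k % n) 0)).trans hl
  have h2 := (label_le l (l.getD (k / n) 0 * l.getD (k % n) 0)).trans hl
  unfold cell
  nlinarith

/-- Positions, sums and products are preserved by `φ`, and so is the default entry 0 beyond the end
of the list. -/
theorem code_map (φ : R ≃+* S) (n : ℕ) (l : List R) : code n (l.map φ) = code n l := by
  have h : ∀ i, (l.map φ).getD i 0 = φ (l.getD i 0) := by
    intro i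
    simp only [List.getD_eq_getElem?_getD, List.getElem?_map]
    cases l[i]? <;> simp
  have h2 : cell n (l.map φ) = cell n l := by
    funext k
    simp only [cell, h, ← map_add, ← map_mul]
    rw [← label_map φ.toAddEquiv l, ← label_map φ.toAddEquiv l]
    rfl
  rw [code, code, h2]

/-- Labels are at most `n`, so every cell is a legitimate digit in base `(n + 1) ^ 2`, and
expansions of equal length are unique. -/
theorem cell_eq_of_code_eq {n : ℕ} (hn : 0 < n) {l : List R} {l' : List S} (hl : l.length ≤ n)
    (hl' : l'.length ≤ n) (h : code n l = code n l') {k : ℕ} (hk : k < n * n) :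
    cell n l k = cell n l' k := by
  have hb : 1 < (n + 1) ^ 2 := Nat.one_lt_pow two_ne_zero (by omega)
  have h1 := Nat.ofDigits_inj_of_len_eq hb (by simp)
    (by simp only [List.mem_map]; rintro _ ⟨k, _, rfl⟩; exact cell_lt hl k)
    (by simp only [List.mem_map]; rintro _ ⟨k, _, rfl⟩; exact cell_lt hl' k) h
  exact List.map_inj_left.1 h1 k (List.mem_range.2 hk)

/-- The isomorphism matches elements in equal positions. Equal codes say that sums and products of
matched pairs again stand in equal positions. -/
theorem nonempty_ringEquiv_of_code_eq {n : ℕ} (hR : Nat.card R = n) (hS : Nat.card S = n)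
    (hn : 0 < n) {l : List R} {l' : List S} (hl : l.Nodup) (hl' : l'.Nodup) (hlen : l.length = n)
    (hlen' : l'.length = n) (h : code n l = code n l') : Nonempty (R ≃+* S) := by
  have all : ∀ {A : Type} {L : List A}, Nat.card A = n → L.Nodup → L.length = n →
      ∀ a, a ∈ L := by
    intro A L h1 h2 h3 a
    have : Finite A := Nat.finite_of_card_ne_zero (by omega)
    have := Fintype.ofFinite A
    classical
    have h4 : L.toFinset = Finset.univ := by
      rw [← Finset.card_eq_iff_eq_univ, List.toFinset_card_of_nodup h2, h3, ← h1,
        Nat.card_eq_fintype_card]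
    rw [← List.mem_toFinset, h4]
    exact Finset.mem_univ a
  have hm := all hR hl hlen
  have hm' := all hS hl' hlen'
  let f : R → S := fun r => l'.getD (l.idxOf r) 0
  have hf : ∀ r, label l' (f r) = label l r := by
    intro r
    have h1 : l.idxOf r < l'.length := by
      rw [hlen', ← hlen]; exact List.idxOf_lt_length_of_mem (hm r)
    simp only [f, List.getD_eq_getElem _ _ h1]
    rw [label_getElem hl' h1]
    simp [label, hm r]
  have hcell : ∀ r s : R, label l (r + s) = label l' (f r + f s) ∧
      label l (r * s) = label l' (f r * f s) := by
    intro r s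
    have h1 : l.idxOf r < n := by rw [← hlen]; exact List.idxOf_lt_length_of_mem (hm r)
    have h2 : l.idxOf s < n := by rw [← hlen]; exact List.idxOf_lt_length_of_mem (hm s)
    have h3 : n * l.idxOf r + l.idxOf s < n * n := by nlinarith
    have h4 := cell_eq_of_code_eq hn hlen.le hlen'.le h h3
    have h5 : (n * l.idxOf r + l.idxOf s) / n = l.idxOf r := by
      rw [Nat.mul_add_div hn, Nat.div_eq_of_lt h2, add_zero]
    have h6 : (n * l.idxOf r + l.idxOf s) % n = l.idxOf s := by
      rw [Nat.mul_add_mod, Nat.mod_eq_of_lt h2]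
    have h7 : ∀ r, l.getD (l.idxOf r) 0 = r := fun r => by
      rw [List.getD_eq_getElem _ _ (List.idxOf_lt_length_of_mem (hm r)), List.getElem_idxOf]
    simp only [cell, h5, h6, h7] at h4
    have h8 : ∀ a, label l a < n + 1 := fun a => by have := label_le l a; omega
    have h9 : ∀ a, label l' a < n + 1 := fun a => by have := label_le l' a; omega
    -- Quotient and remainder by `n + 1` separate the label of the sum from that of the product.
    have h10 := congrArg (· / (n + 1)) h4
    have h11 := congrArg (· % (n + 1)) h4
    simp only [mul_comm _ (n + 1), Nat.mul_add_div (Nat.succ_pos n), Nat.mul_add_mod,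
      Nat.div_eq_of_lt (h8 _), Nat.div_eq_of_lt (h9 _), Nat.mod_eq_of_lt (h8 _),
      Nat.mod_eq_of_lt (h9 _), add_zero] at h10 h11
    exact ⟨h10, h11⟩
  have hadd : ∀ r s, f (r + s) = f r + f s := fun r s =>
    eq_of_label_eq (hm' _) (hm' _) ((hf _).trans (hcell r s).1)
  have hmul : ∀ r s, f (r * s) = f r * f s := fun r s =>
    eq_of_label_eq (hm' _) (hm' _) ((hf _).trans (hcell r s).2)
  have h0 : f 0 = 0 := by simpa using hadd 0 0
  let F : R →ₙ+* S := { toFun := f, map_mul' := hmul, map_zero' := h0, map_add' := hadd }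
  have hinj : Function.Injective f := fun r s hrs =>
    eq_of_label_eq (hm r) (hm s) (by rw [← hf, ← hf, hrs])
  have : Finite R := Nat.finite_of_card_ne_zero (by omega)
  have : Finite S := Nat.finite_of_card_ne_zero (by omega)
  have hbij : Function.Bijective f :=
    (Nat.bijective_iff_injective_and_card f).2 ⟨hinj, hR.trans hS.symm⟩
  exact ⟨RingEquiv.ofBijective F hbij⟩

end Code

/-! ## The two families of codes -/

section Families

variable {R S : Type} [NonUnitalRing R] [DecidableEq R] [NonUnitalRing S] [DecidableEq S]

/-- The lists for the first ring: greedy choices, then choices by digits. -/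
def fstList (n m : ℕ) (g : List R → R) (d : ℕ → R) (T : ℕ) : List R :=
  byDigits n d m T (greedy n g m [0])

/-- The lists for the second ring: choices by digits, then greedy choices. -/
def sndList (n m : ℕ) (g : List R → R) (d : ℕ → R) (T : ℕ) : List R :=
  greedy n g m (byDigits n d m T [0])

theorem nodup_greedy (n m : ℕ) (g : List R → R) {l : List R} (hl : l.Nodup) :
    (greedy n g m l).Nodup := by
  induction m with
  | zero => exact hl
  | succ m ih => rw [greedy, Function.iterate_succ_apply']; exact nodup_extend ih _

theorem nodup_byDigits (n m : ℕ) (d : ℕ → R) (T : ℕ) {l : List R} (hl : l.Nodup) :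
    (byDigits n d m T l).Nodup := by
  induction m generalizing T l with
  | zero => exact hl
  | succ m ih => exact ih _ (nodup_extend hl _)

theorem nodup_fstList (n m : ℕ) (g : List R → R) (d : ℕ → R) (T : ℕ) :
    (fstList n m g d T).Nodup :=
  nodup_byDigits _ _ _ _ (nodup_greedy _ _ _ (List.nodup_singleton 0))

theorem nodup_sndList (n m : ℕ) (g : List R → R) (d : ℕ → R) (T : ℕ) :
    (sndList n m g d T).Nodup :=
  nodup_greedy _ _ _ (nodup_byDigits _ _ _ _ (List.nodup_singleton 0))

/-- Two rings are isomorphic if and only if the two families of codes collide. -/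
theorem nonempty_ringEquiv_iff_collision {n m : ℕ} (hn : 0 < n) (hR : Nat.card R = n)
    (hS : Nat.card S = n) (hm : n ≤ n.minFac ^ m * n.minFac ^ m) {gR : List R → R} {dR : ℕ → R}
    {gS : List S → S} {dS : ℕ → S} (hgR : Chooses gR) (hgS : Chooses gS)
    (hdR : ∀ r, ∃ i < n, dR i = r) (hdS : ∀ s, ∃ i < n, dS i = s) :
    Nonempty (R ≃+* S) ↔ ∃ T < n ^ m, ∃ U < n ^ m,
      (fstList n m gR dR T).length = n ∧ (sndList n m gS dS U).length = n ∧
        code n (fstList n m gR dR T) = code n (sndList n m gS dS U) := by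
  constructor
  · rintro ⟨φ⟩
    have : Finite R := Nat.finite_of_card_ne_zero (by omega)
    have : Finite S := Nat.finite_of_card_ne_zero (by omega)
    obtain ⟨xs, hxs, h1⟩ := greedy_eq_extendAll n gR m [0]
    obtain ⟨K, hK, h2⟩ := greedy_spec hR.symm hgR m (enumerates_zero R)
    -- `U` encodes the images in `S` of the greedy choices made in `R`.
    obtain ⟨U, hU, h3⟩ := exists_byDigits hdS (xs.map φ) [0]
    have h4 : byDigits n dS m U [0] = (greedy n gR m [0]).map φ := by
      rw [List.length_map, hxs] at h3
      rw [h3, h1, ← show (⇑φ.toAddEquiv) = φ from rfl, ← map_extendAll]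
      simp
    obtain ⟨ys, hys, h5⟩ := greedy_eq_extendAll n gS m (byDigits n dS m U [0])
    have hK' : Enumerates (byDigits n dS m U [0]) (K.map (φ : R →+ S)) := by
      rw [h4]
      refine ⟨hK.1.map φ.injective, fun a => ?_⟩
      simp [hK.2]
    obtain ⟨K', hK', h6⟩ := greedy_spec hS.symm hgS m hK'
    -- `T` encodes the preimages in `R` of the greedy choices that complete the list in `S`.
    obtain ⟨T, hT, h7⟩ := exists_byDigits hdR (ys.map φ.symm) (greedy n gR m [0])
    have h8 : (fstList n m gR dR T).map φ = sndList n m gS dS U := by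
      rw [List.length_map, hys] at h7
      rw [sndList, h5, h4, fstList, h7, ← show (⇑φ.toAddEquiv) = φ from rfl, ← map_extendAll]
      simp [List.map_map, Function.comp_def]
    -- Unless one half already reaches order `n`, each half contributes a factor of at least
    -- `n.minFac ^ m`, and `hm` says that the two together suffice.
    have h9 : (sndList n m gS dS U).length = n := by
      rcases h6 with h6 | h6
      · exact h6
      · rw [h4, List.length_map] at h6
        refine le_antisymm ?_ ?_
        · have := Fintype.ofFinite S
          have h10 := (nodup_sndList n m gS dS U).length_le_card
          rwa [← Nat.card_eq_fintype_card, hS] at h10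
        · rw [sndList, h4]
          rcases h2 with h2 | h2
          · rw [h2] at h6
            exact (Nat.le_mul_of_pos_left n (pow_pos n.minFac_pos m)).trans h6
          · rw [List.length_singleton, mul_one] at h2
            exact (hm.trans (Nat.mul_le_mul_left _ h2)).trans h6
    refine ⟨T, by simpa [hys] using hT, U, by simpa [hxs] using hU, ?_, h9, ?_⟩
    · rwa [← h8, List.length_map] at h9
    · rw [← h8, code_map]
  · rintro ⟨T, -, U, -, h1, h2, h3⟩
    exact nonempty_ringEquiv_of_code_eq hR hS hn (nodup_fstList ..) (nodup_sndList ..) h1 h2 h3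

end Families

end ListClosure

namespace RAM

open ListClosure

/-! ## The program that lists the elements of a ring and computes its code

The variables are: 0 the answer, 1 the order `n`, 2 the smallest prime factor, 3 its power, 4 the
number of tuples, 5 their length, 6 the address of the work space, 7 to 10 counters, 11 the
position in the list, 12 the length of the list, 13 the translating element, 15 the code, and
14, 16, 17 auxiliary ones. -/

/-- The address of the work space. -/
def base (n : ℕ) : ℕ := 4 * n * n + 1

section Model

variable {n : ℕ} {R : Type} [NonUnitalRing R] (e : R ≃ Fin n)

/-- The least number of an element outside a list. -/
noncomputable def leastMissing (l : List R) : ℕ := sInf {i | ∃ r, r ∉ l ∧ (e r : ℕ) = i}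

theorem leastMissing_lt (l : List R) : leastMissing e l < n := by
  by_cases h : {i | ∃ r, r ∉ l ∧ (e r : ℕ) = i}.Nonempty
  · obtain ⟨r, -, hr⟩ := Nat.sInf_mem h
    rw [leastMissing, ← hr]; exact (e r).2
  -- For a complete list the infimum takes its default value 0, a valid number because the ring has
  -- an element.
  · rw [leastMissing, Set.not_nonempty_iff_eq_empty.1 h, Nat.sInf_empty]
    exact (e 0).pos

/-- The element with the least number outside a list. -/
noncomputable def firstMissing (l : List R) : R := e.symm ⟨leastMissing e l, leastMissing_lt e l⟩

theorem chooses_firstMissing : Chooses (firstMissing e) := by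
  rintro l ⟨r, hr⟩
  have h : {i | ∃ r, r ∉ l ∧ (e r : ℕ) = i}.Nonempty := ⟨_, r, hr, rfl⟩
  obtain ⟨r', h1, h2⟩ := Nat.sInf_mem h
  have h3 : firstMissing e l = r' := by
    rw [firstMissing, Equiv.symm_apply_eq]; exact Fin.ext h2.symm
  rwa [h3]

/-- The element with a given number. -/
def numbered (i : ℕ) : R := if h : i < n then e.symm ⟨i, h⟩ else 0

theorem apply_numbered {i : ℕ} (h : i < n) : (e (numbered e i) : ℕ) = i := by
  simp [numbered, h]

theorem exists_numbered (r : R) : ∃ i < n, numbered e i = r :=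
  ⟨e r, (e r).2, by simp [numbered]⟩

/-- The tables of the ring are stored in memory, after `f` other tables. -/
structure Input (f : ℕ) (σ : State) : Prop where
  le : f ≤ 2
  order : σ.reg 1 = n
  base : σ.reg 6 = base n
  add : ∀ a b : R, σ.mem (1 + f * n * n + (e a * n + e b)) = e (a + b)
  mul : ∀ a b : R, σ.mem (1 + (f + 1) * n * n + (e a * n + e b)) = e (a * b)

end Model

/-- A list of elements and the labels are stored in the work space. -/
structure Holds {n : ℕ} {R : Type} [DecidableEq R] (e : R ≃ Fin n) (l : List R) (σ : State) : Prop where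
  nodup : l.Nodup
  length : σ.reg 12 = l.length
  entry : ∀ j (h : j < l.length), σ.mem (RAM.base n + n + j) = e l[j]
  label : ∀ r, σ.mem (RAM.base n + e r) = label l r

/-- Two states agree on the first `K` variables and on the memory outside the work space. -/
structure Same (n K : ℕ) (σ₀ σ : State) : Prop where
  reg : ∀ r < K, σ.reg r = σ₀.reg r
  mem : ∀ x, x < base n ∨ base n + 2 * n ≤ x → σ.mem x = σ₀.mem x

/-! ### Preservation of variables, input tables and work space -/

section Lemmas

variable {n K V f : ℕ} {σ₀ σ σ' : State} {R : Type} [NonUnitalRing R]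
  {e : R ≃ Fin n} {A : Type} [DecidableEq A] {a : A ≃ Fin n} {l : List A}

theorem Same.refl (n K : ℕ) (σ : State) : Same n K σ σ := ⟨fun _ _ => rfl, fun _ _ => rfl⟩

theorem Same.trans {K' : ℕ} (h : Same n K σ₀ σ) (h' : Same n K' σ σ') (hK : K ≤ K') :
    Same n K σ₀ σ' :=
  ⟨fun r hr => (h'.reg r (hr.trans_le hK)).trans (h.reg r hr),
    fun x hx => (h'.mem x hx).trans (h.mem x hx)⟩

theorem Same.setReg (h : Same n K σ₀ σ) {r : ℕ} (hr : K ≤ r) (v : ℕ) :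
    Same n K σ₀ (σ.setReg r v) :=
  ⟨fun r' hr' => by rw [State.setReg_reg, if_neg (by omega), h.reg r' hr'], h.mem⟩

theorem Same.setMem (h : Same n K σ₀ σ) {x : ℕ} (hx : base n ≤ x) (hx' : x < base n + 2 * n)
    (v : ℕ) : Same n K σ₀ (σ.setMem x v) :=
  ⟨h.reg, fun y hy => by rw [State.setMem_mem, if_neg (by omega), h.mem y hy]⟩

theorem Holds.setReg (h : Holds a l σ) {r : ℕ} (hr : r ≠ 12) (v : ℕ) :
    Holds a l (σ.setReg r v) :=
  ⟨h.nodup, by rw [State.setReg_reg, if_neg hr.symm, h.length], h.entry, h.label⟩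

theorem Holds.length_le (h : Holds a l σ) : l.length ≤ n := by
  have := Fintype.ofEquiv _ a.symm
  have h1 := h.nodup.length_le_card
  rwa [Fintype.card_congr a, Fintype.card_fin] at h1

/-- All four tables lie below the work space, since `4 * n * n + 1` is the length of the input. -/
theorem Input.of_eq (h : Input e f σ₀) (h1 : σ.reg 1 = σ₀.reg 1) (h6 : σ.reg 6 = σ₀.reg 6)
    (hm : ∀ x < RAM.base n, σ.mem x = σ₀.mem x) : Input e f σ := by
  have hlt : ∀ a b : R, ∀ g ≤ 3, 1 + g * n * n + (e a * n + e b) < RAM.base n := by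
    intro a b g hg
    have h1 := (e a).2
    have h2 := (e b).2
    have h3 : (e a : ℕ) * n + e b < n * n := by nlinarith
    have h4 : g * (n * n) ≤ 3 * (n * n) := Nat.mul_le_mul_right _ hg
    unfold RAM.base
    nlinarith
  have := h.le
  refine ⟨h.le, h1.trans h.order, h6.trans h.base, fun a b => ?_, fun a b => ?_⟩
  · rw [hm _ (hlt a b f (by omega)), h.add]
  · rw [hm _ (hlt a b (f + 1) (by omega)), h.mul]

theorem Input.of_same (h : Input e f σ₀) (h' : Same n K σ₀ σ) (hK : 7 ≤ K) : Input e f σ :=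
  h.of_eq (h'.reg 1 (by omega)) (h'.reg 6 (by omega)) fun x hx => h'.mem x (.inl hx)

end Lemmas

/-- The address of an entry of an operation table, after `f` other tables. -/
def tableEx (f : ℕ) (a b : Ex) : Ex := .const 1 + .const f * .var 1 * .var 1 + (a * .var 1 + b)

@[simp] theorem val_tableEx (f : ℕ) (a b : Ex) (s : State) :
    (tableEx f a b).val s = 1 + f * s.reg 1 * s.reg 1 + (a.val s * s.reg 1 + b.val s) := rfl

/-- The address of the label of an element. -/
def labelEx (a : Ex) : Ex := .var 6 + a

@[simp] theorem val_labelEx (a : Ex) (s : State) : (labelEx a).val s = s.reg 6 + a.val s := rfl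

/-- The address of an entry of the list. -/
def entryEx (a : Ex) : Ex := .var 6 + .var 1 + a

@[simp] theorem val_entryEx (a : Ex) (s : State) :
    (entryEx a).val s = s.reg 6 + s.reg 1 + a.val s := rfl

/-- Decrement a variable. -/
def decr (r : ℕ) : Prog := asg r (.var r - .const 1)

/-- Close the list under translation by the element in variable 13. -/
def extendProg (f : ℕ) : Prog :=
  .seq (asg 11 (.const 0)) <| .seq (asg 10 (.var 1)) <| .whileNZ 10 <|
    .seq (ite (.var 12 - .var 11)
      (.seq (asg 14 (.load (tableEx f (.load (entryEx (.var 11))) (.var 13)))) <|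
        .seq (asg 11 (.var 11 + .const 1)) <|
        ite (.load (labelEx (.var 14))) .skip
          (.seq (sto (entryEx (.var 12)) (.var 14)) <| .seq (asg 12 (.var 12 + .const 1)) <|
            sto (labelEx (.var 14)) (.var 12)))
      .skip)
    (decr 10)

/-- Find the first element outside the list. -/
def missingProg : Prog :=
  .seq (asg 13 (.const 0)) <| .seq (asg 10 (.var 1)) <| .whileNZ 10 <|
    .seq (ite (.load (labelEx (.var 10 - .const 1))) .skip (asg 13 (.var 10 - .const 1))) (decr 10)

/-- Split off the lowest digit of variable 9. -/
def digitProg : Prog :=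
  .seq (asg 13 (.var 9 - .var 9 / .var 1 * .var 1)) (asg 9 (.var 9 / .var 1))

/-- Extend the list by elements supplied by `P`. -/
def halfProg (f : ℕ) (P : Prog) : Prog :=
  .seq (asg 8 (.var 5)) <| .whileNZ 8 <| .seq P <| .seq (extendProg f) (decr 8)

/-- Start with the list that consists of the zero element. -/
def startProg (f : ℕ) : Prog :=
  .seq (asg 14 (.const 0)) <| .seq (asg 10 (.var 1 - .const 1)) <|
  .seq (.whileNZ 10 (.seq (asg 14 (.load (tableEx f (.var 14) (.const 0)))) (decr 10))) <|
  .seq (asg 10 (.var 1)) <|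
  .seq (.whileNZ 10 (.seq (sto (labelEx (.var 10 - .const 1)) (.const 0)) (decr 10))) <|
  .seq (sto (entryEx (.const 0)) (.var 14)) <| .seq (sto (labelEx (.var 14)) (.const 1))
  (asg 12 (.const 1))

/-- Compute the code. -/
def codeProg (f : ℕ) : Prog :=
  .seq (asg 15 (.const 0)) <| .seq (asg 10 (.var 1 * .var 1)) <| .whileNZ 10 <|
    .seq (asg 16 ((.var 10 - .const 1) / .var 1)) <|
    .seq (asg 17 (.var 10 - .const 1 - .var 16 * .var 1)) <|
    .seq (asg 16 (.load (entryEx (.var 16)))) <|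
    .seq (asg 17 (.load (entryEx (.var 17)))) <|
    .seq (asg 15 (.var 15 * (.var 1 + .const 1) +
      .load (labelEx (.load (tableEx f (.var 16) (.var 17)))))) <|
    .seq (asg 15 (.var 15 * (.var 1 + .const 1) +
      .load (labelEx (.load (tableEx (f + 1) (.var 16) (.var 17)))))) <|
    decr 10

/-! ### Correctness and time of the routines on lists -/

section Specs

variable {n V f : ℕ} {R : Type} [NonUnitalRing R] [DecidableEq R] {e : R ≃ Fin n}

theorem Run.decr {r k : ℕ} {σ : State} {Q : State → Prop} (hV : k < V) (hr : r < 32)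
    (h : σ.reg r = k + 1) (hQ : Q (σ.setReg r k)) : Run V (decr r) σ 1 Q := by
  have h1 : (Ex.var r - Ex.const 1).val σ = k := by simp [h]
  refine .asg ?_ hr (by rwa [h1]) (by rwa [h1])
  simp only [Ex.good, Ex.wf, Ex.weight, Ex.deg, HSub.hSub, Sub.sub]
  simpa using hr

theorem good_tableEx_extend (hf : f ≤ 2) :
    (Ex.load (tableEx f (.load (entryEx (.var 11))) (.var 13))).good = true := by
  interval_cases f <;> rfl

/-- One round of the program is one application of `step`; beyond the end of the list both do
nothing. The membership test is a single look at the label, which is 0 exactly for missing elements.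
-/
theorem run_extendStep (hV : n + 8 < V) {σ₀ σ : State} (hI : Input e f σ₀)
    (hS : Same n 10 σ₀ σ) {l : List R} {j : ℕ} {x : R} (hH : Holds e l σ) (hj : σ.reg 11 = j)
    (hx : σ.reg 13 = e x) :
    Run V (RAM.ite (.var 12 - .var 11)
      (.seq (asg 14 (.load (tableEx f (.load (entryEx (.var 11))) (.var 13)))) <|
        .seq (asg 11 (.var 11 + .const 1)) <|
        ite (.load (labelEx (.var 14))) .skip
          (.seq (sto (entryEx (.var 12)) (.var 14)) <| .seq (asg 12 (.var 12 + .const 1)) <|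
            sto (labelEx (.var 14)) (.var 12)))
      .skip) σ 15 fun σ' => σ'.reg 10 = σ.reg 10 ∧ Same n 10 σ₀ σ' ∧ Holds e (step x (l, j)).1 σ' ∧
        σ'.reg 11 = (step x (l, j)).2 ∧ σ'.reg 13 = e x := by
  have hI' := hI.of_same hS (by omega)
  have hlen := hH.length_le
  refine Run.mono (N := 2 + 13) ?_ le_rfl (fun _ h => h)
  refine Run.ite (by rfl) (fun h => ?_) (fun h => ?_)
  · simp only [Ex.val_sub, Ex.val_var, hH.length, hj] at h
    have hjl : j < l.length := by omega
    have hstep : step x (l, j) = (push l (l[j] + x), j + 1) := by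
      simp [step, List.getElem?_eq_getElem hjl]
    rw [hstep]
    have hv : (Ex.load (tableEx f (.load (entryEx (.var 11))) (.var 13))).val σ = e (l[j] + x) := by
      simp [hI'.order, hI'.base, hj, hH.entry j hjl, hx, hI'.add]
    generalize hy : l[j] + x = y at hv
    have hylt := (e y).2
    refine Run.mono (N := 1 + (1 + (2 + 9))) ?_ (by omega) (fun _ h => h)
    refine .asg_seq (good_tableEx_extend hI.le) (by omega) (by omega) ?_
    rw [hv]
    refine .asg_seq (by rfl) (by omega) (by simp [hj]; omega) ?_
    refine Run.ite (by rfl) (fun h => ?_) (fun h => ?_)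
    · simp [hI'.base, hH.label, label_eq_zero] at h
      rw [push, if_pos h]
      refine Run.mono (.skip ?_) (by omega) (fun _ h => h)
      refine ⟨by simp, (hS.setReg (by omega) _).setReg (by omega) _,
        (hH.setReg (by omega) _).setReg (by omega) _, by simp [hj], by simp [hx]⟩
    · simp [hI'.base, hH.label, label_eq_zero] at h
      rw [push, if_neg h]
      -- There is room for the new entry, because `l ++ [y]` has no repetitions.
      have hlt : l.length < n := by
        have := Fintype.ofEquiv _ e.symm
        have h1 : (l ++ [y]).Nodup := by simpa [push, h] using nodup_push hH.nodup y
        have h1 := h1.length_le_card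
        rw [Fintype.card_congr e, Fintype.card_fin] at h1
        simpa using h1
      refine Run.mono (N := 4 + (1 + 4)) ?_ (by omega) (fun _ h => h)
      refine .sto_seq (by rfl) (by rfl) (by simp; omega) ?_
      refine .asg_seq (by rfl) (by omega) (by simp [hH.length]; omega) ?_
      refine .sto (by rfl) (by rfl) (by simp [hH.length]; omega) ?_
      simp only [Ex.val_var, Ex.val_add, Ex.val_const, val_labelEx, val_entryEx, State.setReg_reg,
        State.setMem_reg, hI'.base, hI'.order, hH.length, hj]
      norm_num
      refine ⟨?_, ?_, hx⟩
      · exact ((((hS.setReg (by omega) _).setReg (by omega) _).setMem (by omega) (by omega)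
          _).setReg (by omega) _).setMem (by omega) (by omega) _
      · refine ⟨by simpa [push, h] using nodup_push hH.nodup y, by simp, ?_, ?_⟩
        · intro i hi
          rw [List.length_append, List.length_singleton] at hi
          simp only [State.setMem_mem, State.setReg_mem]
          rw [if_neg (by omega)]
          rcases Nat.lt_succ_iff_lt_or_eq.1 hi with hi | rfl
          · rw [if_neg (by omega), List.getElem_append_left hi, hH.entry i hi]
          · simp
        · intro r
          have hr := (e r).2
          simp only [State.setMem_mem, State.setReg_mem]
          by_cases hry : r = y
          · subst hry
            simp [label_append_self h]
          · have h2 : (e r : ℕ) ≠ e y := fun h => hry (e.injective (Fin.ext h))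
            rw [if_neg (by omega), if_neg (by omega), label_append_of_ne hry, hH.label]
  · simp only [Ex.val_sub, Ex.val_var, hH.length, hj] at h
    have hstep : step x (l, j) = (l, j) := by
      simp [step, List.getElem?_eq_none (show l.length ≤ j by omega)]
    rw [hstep]
    exact Run.mono (.skip ⟨rfl, hS, hH, hj, hx⟩) (by omega) (fun _ h => h)

theorem run_extend (hV : n + 8 < V) {σ : State} (hI : Input e f σ) {l : List R} {x : R}
    (hH : Holds e l σ) (hx : σ.reg 13 = e x) :
    Run V (extendProg f) σ (17 * n + 3) fun σ' => Same n 10 σ σ' ∧ Holds e (extend n x l) σ' := by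
  have hlt : n < V := by omega
  refine Run.mono (N := 1 + (1 + (n * ((15 + 1) + 1) + 1))) ?_ (by omega) (fun _ h => h)
  refine .asg_seq (by rfl) (by omega) (by simp; omega) ?_
  refine .asg_seq (by rfl) (by omega) (by simp [hI.order]; omega) ?_
  refine Run.mono (Run.loop (r := 10) (I := fun k σ' => k ≤ n ∧ Same n 10 σ σ' ∧
    Holds e ((step x)^[n - k] (l, 0)).1 σ' ∧ σ'.reg 11 = ((step x)^[n - k] (l, 0)).2 ∧
    σ'.reg 13 = e x) (by omega) ?_ n _ ?_ (by simp [hI.order])) le_rfl ?_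
  · rintro k σ' ⟨hk, hS, hH', hj, hx'⟩ hc
    refine Run.seq (run_extendStep hV hI hS hH' hj hx') ?_
    rintro σ'' ⟨h1, h2, h3, h4, h5⟩
    have h6 : step x ((step x)^[n - (k + 1)] (l, 0)) = (step x)^[n - k] (l, 0) := by
      rw [← Function.iterate_succ_apply' (step x), show (n - (k + 1)).succ = n - k by omega]
    rw [Prod.mk.eta, h6] at h3 h4
    refine Run.decr (k := k) (by omega) (by omega) (h1.trans hc) ?_
    exact ⟨by simp, by omega, h2.setReg (by omega) _, h3.setReg (by omega) _, by simp [h4],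
      by simp [h5]⟩
  · refine ⟨le_rfl, ((Same.refl _ _ _).setReg (by omega) _).setReg (by omega) _, ?_, ?_, ?_⟩
    · simpa using (hH.setReg (by omega) _).setReg (by omega) _
    · simp
    · simp [hx]
  · rintro σ' ⟨-, -, h1, h2, -⟩
    exact ⟨h1, h2⟩

theorem run_missing (hV : n + 8 < V) {σ : State} (hI : Input e f σ) {l : List R}
    (hH : Holds e l σ) :
    Run V missingProg σ (5 * n + 3) fun σ' => Same n 10 σ σ' ∧ Holds e l σ' ∧
      σ'.reg 13 = e (firstMissing e l) := by
  have hlt : n < V := by omega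
  refine Run.mono (N := 1 + (1 + (n * ((3 + 1) + 1) + 1))) ?_ (by omega) (fun _ h => h)
  refine .asg_seq (by rfl) (by omega) (by simp; omega) ?_
  refine .asg_seq (by rfl) (by omega) (by simp [hI.order]; omega) ?_
  -- The scan goes downwards, so the last number written is the least one. The infimum of the empty
  -- set is 0, which agrees with the initial value of variable 13.
  refine Run.mono (Run.loop (r := 10) (I := fun k σ' => k ≤ n ∧ Same n 10 σ σ' ∧ Holds e l σ' ∧
    σ'.reg 13 = sInf {i | k ≤ i ∧ ∃ r, r ∉ l ∧ (e r : ℕ) = i}) (by omega) ?_ n _ ?_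
    (by simp [hI.order])) le_rfl ?_
  · rintro k σ' ⟨hk, hS, hH', hx⟩ hc
    have hI' := hI.of_same hS (by omega)
    have hlab : σ'.mem (base n + k) = label l (numbered e k) := by
      have := hH'.label (numbered e k)
      rwa [apply_numbered e (by omega)] at this
    refine Run.seq (Q := fun σ'' => σ''.reg 10 = k + 1 ∧ Same n 10 σ σ'' ∧ Holds e l σ'' ∧
      σ''.reg 13 = sInf {i | k ≤ i ∧ ∃ r, r ∉ l ∧ (e r : ℕ) = i})
      (Run.ite (N := 1) (by rfl) (fun h => ?_) (fun h => ?_)) ?_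
    · simp [hc, hI'.base, hlab, label_eq_zero] at h
      refine .skip ⟨hc, hS, hH', ?_⟩
      rw [hx]
      congr 1
      ext i
      refine ⟨fun h => ⟨Nat.le_of_succ_le h.1, h.2⟩, fun ⟨h1, r, h2, h3⟩ => ⟨?_, r, h2, h3⟩⟩
      rcases h1.eq_or_lt with rfl | h1
      · subst h3
        simp [numbered, h2] at h
      · exact h1
    · simp [hc, hI'.base, hlab, label_eq_zero] at h
      refine .asg (by rfl) (by omega) (by simp [hc]; omega) ⟨by simp [hc],
        hS.setReg (by omega) _, hH'.setReg (by omega) _, ?_⟩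
      have : IsLeast {i | k ≤ i ∧ ∃ r, r ∉ l ∧ (e r : ℕ) = i} k :=
        ⟨⟨le_rfl, _, h, apply_numbered e (by omega)⟩, fun i hi => hi.1⟩
      simp [hc, this.csInf_eq]
    · rintro σ'' ⟨h1, h2, h3, h4⟩
      refine Run.decr (k := k) (by omega) (by omega) h1 ?_
      exact ⟨by simp, by omega, h2.setReg (by omega) _, h3.setReg (by omega) _, by simp [h4]⟩
  · refine ⟨le_rfl, ((Same.refl _ _ _).setReg (by omega) _).setReg (by omega) _,
      (hH.setReg (by omega) _).setReg (by omega) _, ?_⟩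
    have : {i | n ≤ i ∧ ∃ r, r ∉ l ∧ (e r : ℕ) = i} = ∅ := by
      ext i
      simp only [Set.mem_ofPred_eq, Set.mem_empty_iff_false, iff_false, not_and]
      rintro h ⟨r, -, rfl⟩
      exact absurd (e r).2 (by omega)
    simp [this]
  · rintro σ' ⟨-, -, h1, h2, h3⟩
    exact ⟨h1, h2, by simp [h3, firstMissing, leastMissing]⟩

theorem run_digit (hV : n + 8 < V) {σ : State} (hI : Input e f σ) {l : List R}
    (hH : Holds e l σ) {T : ℕ} (hT : σ.reg 9 = T) (hTV : T < V) :
    Run V digitProg σ 2 fun σ' => Same n 9 σ σ' ∧ Holds e l σ' ∧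
      σ'.reg 13 = e (numbered e (T % n)) ∧ σ'.reg 9 = T / n := by
  have hn : 0 < n := (e 0).pos
  have hmod : T - T / n * n = T % n := by
    have := Nat.div_add_mod' T n
    omega
  have := Nat.mod_lt T hn
  have := Nat.div_le_self T n
  refine Run.mono (N := 1 + 1) ?_ le_rfl (fun _ h => h)
  refine .asg_seq (by rfl) (by omega) (by simp [hI.order, hT, hmod]; omega) ?_
  refine .asg (by rfl) (by omega) (by simp [hI.order, hT]; omega) ?_
  refine ⟨((Same.refl _ _ _).setReg (by omega) _).setReg (by omega) _,
    (hH.setReg (by omega) _).setReg (by omega) _, ?_, by simp [hI.order, hT]⟩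
  rw [apply_numbered e (by assumption)]
  simp [hI.order, hT, hmod]

/-- Variable 9 is tracked separately because it holds the tuple that a later digit half may still
need. -/
theorem run_greedyHalf (hV : n + 8 < V) {σ : State} (hI : Input e f σ) {l : List R}
    (hH : Holds e l σ) {m : ℕ} (hm : σ.reg 5 = m) (hmV : m < V) :
    Run V (halfProg f missingProg) σ (m * (22 * n + 8) + 2) fun σ' => Same n 8 σ σ' ∧
      σ'.reg 9 = σ.reg 9 ∧ Holds e (greedy n (firstMissing e) m l) σ' := by
  refine Run.mono (N := 1 + (m * ((5 * n + 3) + ((17 * n + 3) + 1) + 1) + 1)) ?_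
    (le_of_eq (by ring)) (fun _ h => h)
  refine .asg_seq (by rfl) (by omega) (by simp [hm]; omega) ?_
  refine Run.mono (Run.loop (r := 8) (I := fun k σ' => k ≤ m ∧ Same n 8 σ σ' ∧
    σ'.reg 9 = σ.reg 9 ∧ Holds e (greedy n (firstMissing e) (m - k) l) σ') (by omega) ?_ m _ ?_
    (by simp [hm])) le_rfl ?_
  · rintro k σ' ⟨hk, hS, h9, hH'⟩ hc
    have hI' := hI.of_same hS (by omega)
    refine Run.seq (run_missing hV hI' hH') ?_
    rintro σ₁ ⟨h1, h2, h3⟩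
    refine Run.seq (run_extend hV (hI'.of_same h1 (by omega)) h2 h3) ?_
    rintro σ₂ ⟨k1, k2⟩
    have hS' := h1.trans k1 (by omega)
    refine Run.decr (k := k) (by omega) (by omega) ((hS'.reg 8 (by omega)).trans hc) ?_
    refine ⟨by simp, by omega, (hS.trans hS' (by omega)).setReg (by omega) _, ?_, ?_⟩
    · simp [hS'.reg 9 (by omega), h9]
    · have : greedy n (firstMissing e) (m - k) l = extend n
          (firstMissing e (greedy n (firstMissing e) (m - (k + 1)) l))
          (greedy n (firstMissing e) (m - (k + 1)) l) := by
        rw [show m - k = m - (k + 1) + 1 by omega]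
        exact Function.iterate_succ_apply' _ _ _
      rw [this]
      exact k2.setReg (by omega) _
  · refine ⟨le_rfl, (Same.refl _ _ _).setReg (by omega) _, by simp, ?_⟩
    rw [Nat.sub_self]
    exact hH.setReg (by omega) _
  · rintro σ' ⟨-, -, h1, h2, h3⟩
    exact ⟨h1, h2, h3⟩

theorem run_digitHalf (hV : n + 8 < V) {σ : State} (hI : Input e f σ) {l : List R}
    (hH : Holds e l σ) {m T : ℕ} (hm : σ.reg 5 = m) (hmV : m < V) (hT : σ.reg 9 = T)
    (hTV : T < V) :
    Run V (halfProg f digitProg) σ (m * (17 * n + 7) + 2) fun σ' => Same n 8 σ σ' ∧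
      Holds e (byDigits n (numbered e) m T l) σ' := by
  refine Run.mono (N := 1 + (m * (2 + ((17 * n + 3) + 1) + 1) + 1)) ?_
    (le_of_eq (by ring)) (fun _ h => h)
  refine .asg_seq (by rfl) (by omega) (by simp [hm]; omega) ?_
  -- The invariant is that the remaining digits, applied to the current list, still lead to the
  -- intended final list.
  refine Run.mono (Run.loop (r := 8) (I := fun k σ' => k ≤ m ∧ Same n 8 σ σ' ∧
    ∃ U l', σ'.reg 9 = U ∧ U < V ∧ Holds e l' σ' ∧
      byDigits n (numbered e) k U l' = byDigits n (numbered e) m T l) (by omega) ?_ m _ ?_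
    (by simp [hm])) le_rfl ?_
  · rintro k σ' ⟨hk, hS, U, l', hU, hUV, hH', heq⟩ hc
    have hI' := hI.of_same hS (by omega)
    refine Run.seq (run_digit hV hI' hH' hU hUV) ?_
    rintro σ₁ ⟨h1, h2, h3, h4⟩
    refine Run.seq (run_extend hV (hI'.of_same h1 (by omega)) h2 h3) ?_
    rintro σ₂ ⟨k1, k2⟩
    have hS' := h1.trans k1 (by omega)
    refine Run.decr (k := k) (by omega) (by omega) ((hS'.reg 8 (by omega)).trans hc) ?_
    refine ⟨by simp, by omega, (hS.trans hS' (by omega)).setReg (by omega) _, _, _, ?_,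
      (Nat.div_le_self U n).trans_lt hUV, k2.setReg (by omega) _, heq⟩
    simp [k1.reg 9 (by omega), h4]
  · exact ⟨le_rfl, (Same.refl _ _ _).setReg (by omega) _, T, l, by simp [hT], hTV,
      hH.setReg (by omega) _, rfl⟩
  · rintro σ' ⟨-, -, h1, U, l', -, -, h2, h3⟩
    rw [← h3]
    exact ⟨h1, h2⟩

theorem good_tableEx_start (hf : f ≤ 2) :
    (Ex.load (tableEx f (.var 14) (.const 0))).good = true := by
  interval_cases f <;> rfl

theorem run_start (hV : n + 8 < V) {σ : State} (hI : Input e f σ) :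
    Run V (startProg f) σ (9 * n + 14) fun σ' => Same n 8 σ σ' ∧ σ'.reg 9 = σ.reg 9 ∧
      Holds e [0] σ' := by
  have hn : 0 < n := (e 0).pos
  refine Run.mono (N := 1 + (1 + (((n - 1) * ((1 + 1) + 1) + 1) + (1 + ((n * ((4 + 1) + 1) + 1)
    + (4 + (4 + 1))))))) ?_ (by omega) (fun _ h => h)
  refine .asg_seq (by rfl) (by omega) (by simp; omega) ?_
  refine .asg_seq (by rfl) (by omega) (by simp [hI.order]; omega) ?_
  -- The number of the zero element is not part of the input. It is found as `n • x` with `x` the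
  -- element numbered 0, using `n - 1` additions.
  refine Run.seq (Run.loop (r := 10) (I := fun k σ' => k ≤ n - 1 ∧ Same n 10 σ σ' ∧
    σ'.reg 14 = e ((n - k) • e.symm ⟨0, hn⟩)) (by omega) ?_ (n - 1) _ ?_ (by simp [hI.order])) ?_
  · rintro k σ' ⟨hk, hS, h14⟩ hc
    have hI' := hI.of_same hS (by omega)
    have hval : (Ex.load (tableEx f (.var 14) (.const 0))).val σ' =
        e ((n - k) • e.symm ⟨0, hn⟩) := by
      have h1 := hI'.add ((n - (k + 1)) • e.symm ⟨0, hn⟩) (e.symm ⟨0, hn⟩)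
      rw [show n - k = n - (k + 1) + 1 by omega, add_smul, one_smul, ← h1]
      simp [hI'.order, h14]
    have := (e ((n - k) • e.symm ⟨0, hn⟩)).2
    refine .asg_seq (good_tableEx_start hI.le) (by omega) (by omega) ?_
    rw [hval]
    refine Run.decr (k := k) (by omega) (by omega) (by simp [hc]) ?_
    exact ⟨by simp, by omega, (hS.setReg (by omega) _).setReg (by omega) _, by simp⟩
  · refine ⟨le_rfl, ((Same.refl _ _ _).setReg (by omega) _).setReg (by omega) _, ?_⟩
    rw [show n - (n - 1) = 1 by omega]
    simp
  rintro σ₁ ⟨-, -, hS₁, h14⟩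
  have hzero : (n - 0) • e.symm ⟨0, hn⟩ = 0 := by
    have h1 : Nat.card R = n := by rw [Nat.card_congr e, Nat.card_fin]
    rw [Nat.sub_zero]
    nth_rw 1 [← h1]
    exact card_nsmul_eq_zero'
  rw [hzero] at h14
  have hI₁ := hI.of_same hS₁ (by omega)
  refine .asg_seq (by rfl) (by omega) (by simp [hI₁.order]; omega) ?_
  -- The labels are cleared explicitly because the work space is reused for every tuple.
  refine Run.seq (Run.loop (r := 10) (I := fun k σ' => k ≤ n ∧ Same n 10 σ σ' ∧
    σ'.reg 14 = e (0 : R) ∧ ∀ i, k ≤ i → i < n → σ'.mem (base n + i) = 0)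
    (by omega) ?_ n _ ?_ (by simp [hI₁.order])) ?_
  · rintro k σ' ⟨hk, hS, h14, h0⟩ hc
    have hI' := hI.of_same hS (by omega)
    refine .sto_seq (by rfl) (by rfl) (by simp; omega) ?_
    refine Run.decr (k := k) (by omega) (by omega) (by simp [hc]) ?_
    simp only [val_labelEx, Ex.val_sub, Ex.val_var, Ex.val_const, hI'.base, hc,
      Nat.add_sub_cancel]
    refine ⟨by simp, by omega, (hS.setMem (by omega) (by omega) _).setReg (by omega) _,
      by simp [h14], ?_⟩
    intro i hi hin
    simp only [State.setReg_mem, State.setMem_mem]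
    split_ifs with h
    · rfl
    · exact h0 i (by omega) hin
  · exact ⟨le_rfl, hS₁.setReg (by omega) _, by simp [h14], fun i h1 h2 => by omega⟩
  rintro σ₂ ⟨-, -, hS₂, h14, h0⟩
  have hI₂ := hI.of_same hS₂ (by omega)
  have hz := (e (0 : R)).2
  refine .sto_seq (by rfl) (by rfl) (by simp [h14]; omega) ?_
  refine .sto_seq (by rfl) (by rfl) (by simp; omega) ?_
  refine .asg (by rfl) (by omega) (by simp; omega) ?_
  simp only [val_labelEx, val_entryEx, Ex.val_var, Ex.val_const, State.setMem_reg, hI₂.base,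
    hI₂.order, h14]
  have hS₃ := ((hS₂.setMem (x := base n + n + 0) (by omega) (by omega) (e (0 : R))).setMem
    (x := base n + e (0 : R)) (by omega) (by omega) 1).setReg (r := 12) (by omega) 1
  refine ⟨⟨fun r hr => hS₃.reg r (by omega), hS₃.mem⟩, hS₃.reg 9 (by omega), ?_⟩
  refine ⟨List.nodup_singleton 0, by simp, ?_, ?_⟩
  · intro j hj
    obtain rfl : j = 0 := by simpa using hj
    simp only [State.setReg_mem, State.setMem_mem]
    rw [if_neg (by omega)]
    simp
  · intro r
    have hr := (e r).2
    simp only [State.setReg_mem, State.setMem_mem]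
    by_cases h : r = 0
    · subst h; simp [label]
    · have h2 : (e r : ℕ) ≠ e (0 : R) := fun h' => h (e.injective (Fin.ext h'))
      rw [if_neg (by omega), if_neg (by omega), h0 _ (by omega) hr]
      simp [label, h]

theorem good_tableEx_code (hf : f ≤ 2) :
    (Ex.var 15 * (.var 1 + .const 1) +
      .load (labelEx (.load (tableEx f (.var 16) (.var 17))))).good = true ∧
    (Ex.var 15 * (.var 1 + .const 1) +
      .load (labelEx (.load (tableEx (f + 1) (.var 16) (.var 17))))).good = true := by
  interval_cases f <;> exact ⟨rfl, rfl⟩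

/-- The part of the code computed from the entries from number `k` on. -/
def partialCode (n : ℕ) (l : List R) (k : ℕ) : ℕ :=
  Nat.ofDigits ((n + 1) ^ 2) (((List.range (n * n)).drop k).map (cell n l))

theorem partialCode_lt {n : ℕ} (hn : 0 < n) {l : List R} (hl : l.length ≤ n) (k : ℕ) :
    partialCode n l k < (n + 1) ^ (2 * (n * n)) := by
  have hb : 1 < (n + 1) ^ 2 := Nat.one_lt_pow two_ne_zero (by omega)
  refine (Nat.ofDigits_lt_base_pow_length hb ?_).trans_le ?_
  · simp only [List.mem_map]
    rintro _ ⟨k, _, rfl⟩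
    exact cell_lt hl k
  · rw [← pow_mul]
    exact Nat.pow_le_pow_right (by omega) (by simp)

theorem partialCode_eq {n : ℕ} (l : List R) {k : ℕ} (hk : k < n * n) :
    partialCode n l k = cell n l k + (n + 1) ^ 2 * partialCode n l (k + 1) := by
  rw [partialCode, List.drop_eq_getElem_cons (by simpa using hk)]
  simp [Nat.ofDigits_cons, partialCode]

/-- This is Horner's scheme from the last cell down to the first; two steps in base `n + 1` make one
digit in base `(n + 1) ^ 2`. -/
theorem run_code (hV : n + 8 < V) (hV' : (n + 1) ^ (2 * (n * n)) ≤ V) (hV2 : n * n < V)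
    {σ : State} (hI : Input e f σ) {l : List R} (hH : Holds e l σ) (hl : l.length = n) :
    Run V (codeProg f) σ (n * n * 8 + 3) fun σ' => Same n 8 σ σ' ∧ σ'.reg 15 = code n l := by
  have hn : 0 < n := (e 0).pos
  refine Run.mono (N := 1 + (1 + (n * n * ((1 + (1 + (1 + (1 + (1 + (1 + 1)))))) + 1) + 1))) ?_
    (by omega) (fun _ h => h)
  refine .asg_seq (by rfl) (by omega) (by simp; omega) ?_
  refine .asg_seq (by rfl) (by omega) (by simpa [hI.order] using hV2) ?_
  refine Run.mono (Run.loop (r := 10) (I := fun k σ' => k ≤ n * n ∧ Same n 8 σ σ' ∧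
    Holds e l σ' ∧ σ'.reg 15 = partialCode n l k) (by omega) ?_ (n * n) _ ?_
    (by simp [hI.order])) le_rfl ?_
  · rintro k σ' ⟨hk, hS, hH', h15⟩ hc
    have hI' := hI.of_same hS (by omega)
    have hq : k / n < n := Nat.div_lt_of_lt_mul (by omega)
    have hr : k % n < n := Nat.mod_lt k hn
    have hmod : k - k / n * n = k % n := by
      have := Nat.div_add_mod' k n
      omega
    have ha : l.getD (k / n) 0 = l[k / n] := List.getD_eq_getElem _ _ (by omega)
    have hb : l.getD (k % n) 0 = l[k % n] := List.getD_eq_getElem _ _ (by omega)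
    have hcode := partialCode_eq (n := n) l (k := k) (by omega)
    have hlt := partialCode_lt hn hl.le k
    rw [cell, ha, hb] at hcode
    have hea := hH'.entry (k / n) (by omega)
    have heb := hH'.entry (k % n) (by omega)
    generalize l[k / n] = a at *
    generalize l[k % n] = b at *
    have h1 := hI'.add a b
    have h2 := hI'.mul a b
    have h3 := hH'.label (a + b)
    have h4 := hH'.label (a * b)
    have hva := (e a).2
    have hvb := (e b).2
    obtain ⟨hg1, hg2⟩ := good_tableEx_code hI.le
    -- The value between the two Horner steps does not exceed the value after them, so it is below
    -- `V` too.
    have hc1 : partialCode n l (k + 1) * (n + 1) + label l (a + b) ≤ partialCode n l k := by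
      rw [hcode]; nlinarith [Nat.zero_le (label l (a + b) * n),
        Nat.zero_le (partialCode n l (k + 1) * (n + 1) * n)]
    refine Run.mono (N := 1 + (1 + (1 + (1 + (1 + (1 + 1)))))) ?_ le_rfl (fun _ h => h)
    refine .asg_seq (by rfl) (by omega) (by simp [hc, hI'.order]; omega) ?_
    refine .asg_seq (by rfl) (by omega) (by simp [hc, hI'.order, hmod]; omega) ?_
    refine .asg_seq (by rfl) (by omega) ?_ ?_
    · simp [hc, hI'.order, hI'.base, hea]; omega
    refine .asg_seq (by rfl) (by omega) ?_ ?_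
    · simp [hc, hI'.order, hI'.base, hmod, heb]; omega
    refine .asg_seq hg1 (by omega) ?_ ?_
    · simp [hc, hI'.order, hI'.base, hmod, hea, heb, h15, h1, h3]; omega
    refine .asg_seq hg2 (by omega) ?_ ?_
    · simp [hc, hI'.order, hI'.base, hmod, hea, heb, h15, h1, h3, h2, h4]
      refine lt_of_eq_of_lt ?_ (hlt.trans_le hV')
      rw [hcode]; ring
    refine Run.decr (k := k) (by nlinarith) (by omega) (by simp [hc]) ?_
    refine ⟨by simp, by omega, ?_, ?_, ?_⟩
    · exact ((((((hS.setReg (by omega) _).setReg (by omega) _).setReg (by omega) _).setReg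
        (by omega) _).setReg (by omega) _).setReg (by omega) _).setReg (by omega) _
    · exact ((((((hH'.setReg (by omega) _).setReg (by omega) _).setReg (by omega) _).setReg
        (by omega) _).setReg (by omega) _).setReg (by omega) _).setReg (by omega) _
    · simp [hc, hI'.order, hI'.base, hmod, hea, heb, h15, h1, h3, h2, h4]
      rw [hcode]; ring
  · refine ⟨le_rfl, ((Same.refl _ _ _).setReg (by omega) _).setReg (by omega) _,
      (hH.setReg (by omega) _).setReg (by omega) _, ?_⟩
    simp [partialCode, List.drop_eq_nil_of_le]
  · rintro σ' ⟨-, -, h1, -, h2⟩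
    exact ⟨h1, by simp [h2, partialCode, code]⟩

end Specs


open ListClosure

/-! ## The complete algorithm -/

/-- List the elements of the first ring: greedy choices, then digits. -/
def fstProg : Prog :=
  .seq (startProg 0) (.seq (halfProg 0 missingProg) (halfProg 0 digitProg))

/-- List the elements of the second ring: digits, then greedy choices. -/
def sndProg : Prog :=
  .seq (startProg 2) (.seq (halfProg 2 digitProg) (halfProg 2 missingProg))

/-- The address of the mark for the code in variable 15. -/
def markEx : Ex := .var 6 + .const 2 * .var 1 + .var 15

/-- A condition which is nonzero if and only if the list is complete. -/
def fullEx : Ex := .const 1 - (.var 1 - .var 12)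

/-- Mark all codes of the first ring. -/
def markProg : Prog :=
  .seq (asg 7 (.var 4)) <| .whileNZ 7 <| .seq (asg 9 (.var 7 - .const 1)) <| .seq fstProg <|
    .seq (ite fullEx (.seq (codeProg 0) (sto markEx (.const 1))) .skip) (decr 7)

/-- Search for a code of the second ring that is marked. -/
def searchProg : Prog :=
  .seq (asg 7 (.var 4)) <| .whileNZ 7 <| .seq (asg 9 (.var 7 - .const 1)) <| .seq sndProg <|
    .seq (ite fullEx (.seq (codeProg 2) (ite (.load markEx) (asg 0 (.const 1)) .skip)) .skip)
      (decr 7)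

/-- Find the smallest prime factor of the order. -/
def factorProg : Prog :=
  .seq (asg 2 (.var 1)) <| .seq (asg 10 (.var 1 - .const 1)) <| .whileNZ 10 <|
    .seq (ite (.const 1 - (.var 1 - .var 1 / (.var 10 + .const 1) * (.var 10 + .const 1)))
      (asg 2 (.var 10 + .const 1)) .skip) (decr 10)

/-- Find the number of digits and the number of tuples. -/
def lengthProg : Prog :=
  .seq (asg 3 (.const 1)) <| .seq (asg 4 (.const 1)) <| .seq (asg 5 (.const 0)) <|
    .seq (asg 10 (.var 1)) <| .whileNZ 10 <|
    .seq (ite (.var 1 - .var 3 * .var 3)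
      (.seq (asg 3 (.var 3 * .var 2)) <| .seq (asg 4 (.var 4 * .var 1)) <|
        asg 5 (.var 5 + .const 1)) .skip) (decr 10)

/-- The algorithm. -/
def isoProg : Prog :=
  .seq (asg 1 (.load (.const 0))) <| .seq (asg 6 (.const 4 * .var 1 * .var 1 + .const 1)) <|
    .seq factorProg <| .seq lengthProg <| .seq markProg searchProg

/-! ### Marking the codes of the first ring and searching with those of the second -/

section Lists

variable {n V m T : ℕ} {R : Type} [NonUnitalRing R] [DecidableEq R] {e : R ≃ Fin n} {σ : State}

theorem run_fst (hV : n + 8 < V) (hI : Input e 0 σ) (hm : σ.reg 5 = m) (hmV : m < V)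
    (hT : σ.reg 9 = T) (hTV : T < V) :
    Run V fstProg σ (9 * n + 18 + m * (39 * n + 15)) fun σ' => Same n 8 σ σ' ∧
      Holds e (fstList n m (firstMissing e) (numbered e) T) σ' := by
  refine Run.mono (Run.seq (run_start hV hI) (fun σ₁ ⟨h1, h2, h3⟩ =>
    Run.seq (run_greedyHalf hV (hI.of_same h1 (by omega)) h3 ((h1.reg 5 (by omega)).trans hm) hmV)
      (fun σ₂ ⟨k1, k2, k3⟩ => Run.mono (run_digitHalf hV
        (hI.of_same (h1.trans k1 le_rfl) (by omega)) k3
        (((h1.trans k1 le_rfl).reg 5 (by omega)).trans hm) hmV (k2.trans (h2.trans hT)) hTV) le_rfl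
          fun σ₃ ⟨l1, l2⟩ => ⟨(h1.trans k1 le_rfl).trans l1 le_rfl, l2⟩))) (le_of_eq (by ring))
    (fun _ h => h)

theorem run_snd (hV : n + 8 < V) (hI : Input e 2 σ) (hm : σ.reg 5 = m) (hmV : m < V)
    (hT : σ.reg 9 = T) (hTV : T < V) :
    Run V sndProg σ (9 * n + 18 + m * (39 * n + 15)) fun σ' => Same n 8 σ σ' ∧
      Holds e (sndList n m (firstMissing e) (numbered e) T) σ' := by
  refine Run.mono (Run.seq (run_start hV hI) (fun σ₁ ⟨h1, h2, h3⟩ =>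
    Run.seq (run_digitHalf hV (hI.of_same h1 (by omega)) h3 ((h1.reg 5 (by omega)).trans hm) hmV
      (h2.trans hT) hTV)
      (fun σ₂ ⟨k1, k3⟩ => Run.mono (run_greedyHalf hV
        (hI.of_same (h1.trans k1 le_rfl) (by omega)) k3
        (((h1.trans k1 le_rfl).reg 5 (by omega)).trans hm) hmV) le_rfl
          fun σ₃ ⟨l1, _, l2⟩ => ⟨(h1.trans k1 le_rfl).trans l1 le_rfl, l2⟩))) (le_of_eq (by ring))
    (fun _ h => h)

theorem val_fullEx_ne_zero {A : Type} [DecidableEq A] {a : A ≃ Fin n} {l : List A}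
    (hn : σ.reg 1 = n) (hH : Holds a l σ) :
    fullEx.val σ ≠ 0 ↔ l.length = n := by
  have := hH.length_le
  simp only [fullEx, Ex.val_sub, Ex.val_const, Ex.val_var, hn, hH.length]
  omega

/-- The time for one tuple. -/
def tupleTime (n m : ℕ) : ℕ := 48 * (n * n) + 9 * n + 30 + m * (39 * n + 15)

/-- The marks start out as zeros and lie beyond the work space, so listing elements never disturbs
them. With `k` rounds to come, exactly the codes of complete lists for tuples `T ≥ k` are marked. -/
theorem run_mark {N : ℕ} (hV : n + 8 < V) (hV' : (n + 1) ^ (2 * (n * n)) ≤ V) (hV2 : n * n < V)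
    (hI : Input e 0 σ) (hm : σ.reg 5 = m) (hmV : m < V) (hN : σ.reg 4 = N) (hNV : N < V)
    (hclean : ∀ c, σ.mem (base n + 2 * n + c) = 0) :
    Run V markProg σ (N * tupleTime n m + 2) fun σ' => (∀ r < 7, σ'.reg r = σ.reg r) ∧
      (∀ x < base n, σ'.mem x = σ.mem x) ∧ ∀ c, σ'.mem (base n + 2 * n + c) ≠ 0 ↔
        ∃ T < N, (fstList n m (firstMissing e) (numbered e) T).length = n ∧
          code n (fstList n m (firstMissing e) (numbered e) T) = c := by
  refine Run.mono (N := 1 + (N * ((1 + ((9 * n + 18 + m * (39 * n + 15)) +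
    ((2 + ((n * n * 8 + 3) + 4)) + 1))) + 1) + 1)) ?_ ?_ (fun _ h => h)
  swap
  · have : N * ((1 + ((9 * n + 18 + m * (39 * n + 15)) +
      ((2 + ((n * n * 8 + 3) + 4)) + 1))) + 1) ≤ N * tupleTime n m :=
      Nat.mul_le_mul_left _ (by unfold tupleTime; omega)
    omega
  refine .asg_seq (by rfl) (by omega) (by simp [hN]; omega) ?_
  refine Run.mono (Run.loop (r := 7) (I := fun k σ' => k ≤ N ∧ (∀ r < 7, σ'.reg r = σ.reg r) ∧
    (∀ x < base n, σ'.mem x = σ.mem x) ∧ ∀ c, σ'.mem (base n + 2 * n + c) ≠ 0 ↔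
      ∃ T, k ≤ T ∧ T < N ∧ (fstList n m (firstMissing e) (numbered e) T).length = n ∧
        code n (fstList n m (firstMissing e) (numbered e) T) = c) (by omega) ?_ N _ ?_
    (by simp [hN])) le_rfl ?_
  · rintro k σ' ⟨hk, hreg, hmem, htab⟩ hc
    refine .asg_seq (by rfl) (by omega) (by simp [hc]; omega) ?_
    have hS₀ := (Same.refl n 8 σ').setReg (r := 9) (by omega)
      ((Ex.var 7 - Ex.const 1).val σ')
    generalize hσ : σ'.setReg 9 ((Ex.var 7 - Ex.const 1).val σ') = σ₁ at hS₀
    have h9 : σ₁.reg 9 = k := by simp [← hσ, hc]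
    have hI₁ : Input e 0 σ₁ :=
      (hI.of_eq (hreg 1 (by omega)) (hreg 6 (by omega)) hmem).of_same hS₀ (by omega)
    refine Run.seq (run_fst hV hI₁ (((hS₀.reg 5 (by omega)).trans (hreg 5 (by omega))).trans hm)
      hmV h9 (by omega)) ?_
    rintro σ₂ ⟨hS₂, hH⟩
    have hI₂ := hI₁.of_same hS₂ (by omega)
    have hfull := val_fullEx_ne_zero hI₂.order hH
    have hS := hS₀.trans hS₂ le_rfl
    refine Run.seq (Q := fun σ₃ => (∀ r < 8, σ₃.reg r = σ'.reg r) ∧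
      (∀ x < base n, σ₃.mem x = σ'.mem x) ∧ ∀ c, σ₃.mem (base n + 2 * n + c) =
      if (fstList n m (firstMissing e) (numbered e) k).length = n ∧
        c = code n (fstList n m (firstMissing e) (numbered e) k) then 1
      else σ'.mem (base n + 2 * n + c)) (Run.ite (by rfl) (fun h => ?_) (fun h => ?_)) ?_
    · rw [hfull] at h
      refine Run.seq (run_code hV hV' hV2 hI₂ hH h) ?_
      rintro σ₃ ⟨hS₃, h15⟩
      have hI₃ := hI₂.of_same hS₃ (by omega)
      have hS' := hS.trans hS₃ le_rfl
      refine .sto (by rfl) (by rfl) (by simp; omega) ⟨fun r hr => hS'.reg r hr, fun x hx => ?_,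
        fun c => ?_⟩
      · simp only [State.setMem_mem, markEx, Ex.val_add, Ex.val_var, Ex.val_mul, Ex.val_const,
          hI₃.base]
        rw [if_neg (by omega), hS'.mem x (.inl hx)]
      · simp only [State.setMem_mem, markEx, Ex.val_add, Ex.val_var, Ex.val_mul, Ex.val_const,
          hI₃.base, hI₃.order, h15, add_right_inj, h, true_and]
        rw [hS'.mem _ (.inr (by omega))]
    · have h' : ¬ (fstList n m (firstMissing e) (numbered e) k).length = n := by
        rw [← hfull]; exact not_not.2 h
      refine Run.mono (.skip ⟨fun r hr => hS.reg r hr, fun x hx => hS.mem x (.inl hx),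
        fun c => ?_⟩) (by omega) (fun _ h => h)
      rw [if_neg (by tauto), hS.mem _ (.inr (by omega))]
    · rintro σ₃ ⟨h1, h2, h3⟩
      refine Run.decr (k := k) (by omega) (by omega) ((h1 7 (by omega)).trans hc) ?_
      refine ⟨by simp, by omega, fun r hr => ?_, fun x hx => (h2 x hx).trans (hmem x hx),
        fun c => ?_⟩
      · rw [State.setReg_reg, if_neg (by omega), h1 r (by omega), hreg r hr]
      · rw [State.setReg_mem, h3 c]
        split_ifs with h
        · exact ⟨fun _ => ⟨k, le_rfl, by omega, h.1, h.2.symm⟩, fun _ => one_ne_zero⟩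
        · rw [htab c]
          refine ⟨fun ⟨T, h4, h5⟩ => ⟨T, by omega, h5⟩, fun ⟨T, h4, h5, h6, h7⟩ =>
            ⟨T, ?_, h5, h6, h7⟩⟩
          rcases h4.eq_or_lt with rfl | h4
          · exact absurd ⟨h6, h7.symm⟩ h
          · exact h4
  · refine ⟨le_rfl, fun r hr => ?_, fun x hx => rfl, fun c => ?_⟩
    · rw [State.setReg_reg, if_neg (by omega)]
    · rw [State.setReg_mem, hclean c]
      simp only [ne_eq, not_true_eq_false, false_iff]
      rintro ⟨T, h1, h2, -⟩
      omega
  · rintro σ' ⟨-, -, h1, h2, h3⟩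
    exact ⟨h1, h2, by simpa using h3⟩

/-- The search writes only into the work space, so the marks can be read off from the initial state
throughout. Variable 0 is exempt from the frame condition since it receives the answer. -/
theorem run_search {N : ℕ} (hV : n + 8 < V) (hV' : (n + 1) ^ (2 * (n * n)) ≤ V) (hV2 : n * n < V)
    (hI : Input e 2 σ) (hm : σ.reg 5 = m) (hmV : m < V) (hN : σ.reg 4 = N) (hNV : N < V)
    (h0 : σ.reg 0 = 0) :
    Run V searchProg σ (N * tupleTime n m + 2) fun σ' =>
      (σ'.reg 0 = 0 ∨ σ'.reg 0 = 1) ∧ (σ'.reg 0 = 1 ↔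
        ∃ T < N, (sndList n m (firstMissing e) (numbered e) T).length = n ∧
          σ.mem (base n + 2 * n + code n (sndList n m (firstMissing e) (numbered e) T)) ≠ 0) := by
  refine Run.mono (N := 1 + (N * ((1 + ((9 * n + 18 + m * (39 * n + 15)) +
    ((2 + ((n * n * 8 + 3) + (2 + 1))) + 1))) + 1) + 1)) ?_ ?_ (fun _ h => h)
  swap
  · have : N * ((1 + ((9 * n + 18 + m * (39 * n + 15)) +
      ((2 + ((n * n * 8 + 3) + (2 + 1))) + 1))) + 1) ≤ N * tupleTime n m :=
      Nat.mul_le_mul_left _ (by unfold tupleTime; omega)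
    omega
  refine .asg_seq (by rfl) (by omega) (by simp [hN]; omega) ?_
  refine Run.mono (Run.loop (r := 7) (I := fun k σ' => k ≤ N ∧
    (∀ r < 7, 0 < r → σ'.reg r = σ.reg r) ∧
    (∀ x, x < base n ∨ base n + 2 * n ≤ x → σ'.mem x = σ.mem x) ∧
    (σ'.reg 0 = 0 ∨ σ'.reg 0 = 1) ∧ (σ'.reg 0 = 1 ↔
      ∃ T, k ≤ T ∧ T < N ∧ (sndList n m (firstMissing e) (numbered e) T).length = n ∧
        σ.mem (base n + 2 * n + code n (sndList n m (firstMissing e) (numbered e) T)) ≠ 0))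
    (by omega) ?_ N _ ?_ (by simp [hN])) le_rfl ?_
  · rintro k σ' ⟨hk, hreg, hmem, h01, hans⟩ hc
    refine .asg_seq (by rfl) (by omega) (by simp [hc]; omega) ?_
    have hS₀ := (Same.refl n 8 σ').setReg (r := 9) (by omega)
      ((Ex.var 7 - Ex.const 1).val σ')
    generalize hσ : σ'.setReg 9 ((Ex.var 7 - Ex.const 1).val σ') = σ₁ at hS₀
    have h9 : σ₁.reg 9 = k := by simp [← hσ, hc]
    have hI₁ : Input e 2 σ₁ := (hI.of_eq (hreg 1 (by omega) (by omega))
      (hreg 6 (by omega) (by omega)) fun x hx => hmem x (.inl hx)).of_same hS₀ (by omega)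
    refine Run.seq (run_snd hV hI₁
      (((hS₀.reg 5 (by omega)).trans (hreg 5 (by omega) (by omega))).trans hm)
      hmV h9 (by omega)) ?_
    rintro σ₂ ⟨hS₂, hH⟩
    have hI₂ := hI₁.of_same hS₂ (by omega)
    have hfull := val_fullEx_ne_zero hI₂.order hH
    have hS := hS₀.trans hS₂ le_rfl
    refine Run.seq (Q := fun σ₃ => (∀ r < 8, 0 < r → σ₃.reg r = σ'.reg r) ∧
      (∀ x, x < base n ∨ base n + 2 * n ≤ x → σ₃.mem x = σ'.mem x) ∧
      ((((sndList n m (firstMissing e) (numbered e) k).length = n ∧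
        σ.mem (base n + 2 * n + code n (sndList n m (firstMissing e) (numbered e) k)) ≠ 0) ∧
        σ₃.reg 0 = 1) ∨
      (¬ ((sndList n m (firstMissing e) (numbered e) k).length = n ∧
        σ.mem (base n + 2 * n + code n (sndList n m (firstMissing e) (numbered e) k)) ≠ 0) ∧
        σ₃.reg 0 = σ'.reg 0))) (Run.ite (by rfl) (fun h => ?_) (fun h => ?_)) ?_
    · rw [hfull] at h
      refine Run.seq (run_code hV hV' hV2 hI₂ hH h) ?_
      rintro σ₃ ⟨hS₃, h15⟩
      have hI₃ := hI₂.of_same hS₃ (by omega)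
      have hS' := hS.trans hS₃ le_rfl
      have hval : (Ex.load markEx).val σ₃ =
          σ.mem (base n + 2 * n + code n (sndList n m (firstMissing e) (numbered e) k)) := by
        simp only [markEx, Ex.val_load, Ex.val_add, Ex.val_var, Ex.val_mul, Ex.val_const,
          hI₃.base, hI₃.order, h15]
        rw [hS'.mem _ (.inr (by omega)), hmem _ (.inr (by omega))]
      refine Run.ite (by rfl) (fun h' => ?_) (fun h' => ?_)
      · rw [hval] at h'
        refine .asg (by rfl) (by omega) (by simp; omega) ⟨fun r hr hr0 => ?_,
          fun x hx => hS'.mem x hx, .inl ⟨⟨h, h'⟩, by simp⟩⟩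
        rw [State.setReg_reg, if_neg (by omega), hS'.reg r hr]
      · rw [hval] at h'
        exact .skip ⟨fun r hr _ => hS'.reg r hr, fun x hx => hS'.mem x hx,
          .inr ⟨fun h4 => h4.2 h', hS'.reg 0 (by omega)⟩⟩
    · have h' : ¬ (sndList n m (firstMissing e) (numbered e) k).length = n := by
        rw [← hfull]; exact not_not.2 h
      exact Run.mono (.skip ⟨fun r hr _ => hS.reg r hr, fun x hx => hS.mem x hx,
        .inr ⟨fun h4 => h' h4.1, hS.reg 0 (by omega)⟩⟩) (by omega) (fun _ h => h)
    · rintro σ₃ ⟨h1, h2, h3⟩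
      refine Run.decr (k := k) (by omega) (by omega) ((h1 7 (by omega) (by omega)).trans hc) ?_
      refine ⟨by simp, by omega, fun r hr hr0 => ?_, fun x hx => (h2 x hx).trans (hmem x hx), ?_⟩
      · rw [State.setReg_reg, if_neg (by omega), h1 r (by omega) hr0, hreg r hr hr0]
      · rw [State.setReg_reg, if_neg (by omega)]
        rcases h3 with ⟨h4, h5⟩ | ⟨h4, h5⟩
        · exact ⟨.inr h5, fun _ => ⟨k, le_rfl, by omega, h4⟩, fun _ => h5⟩
        · rw [h5]
          refine ⟨h01, hans.trans ⟨fun ⟨T, h6, h7⟩ => ⟨T, by omega, h7⟩, fun ⟨T, h6, h7, h8⟩ =>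
            ⟨T, ?_, h7, h8⟩⟩⟩
          rcases h6.eq_or_lt with rfl | h6
          · exact absurd h8 h4
          · exact h6
  · refine ⟨le_rfl, fun r hr hr0 => ?_, fun x hx => rfl, ?_⟩
    · rw [State.setReg_reg, if_neg (by omega)]
    · simp only [State.setReg_reg, h0]
      refine ⟨.inl rfl, by simp, ?_⟩
      rintro ⟨T, h1, h2, -⟩
      omega
  · rintro σ' ⟨-, -, -, -, h1, h2⟩
    exact ⟨h1, by simpa using h2⟩

end Lists

/-! ### The smallest prime factor and the number of digits -/

section Parameters

variable {n V : ℕ} {σ : State}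

theorem run_factor (hV : n + 8 < V) (hn : 0 < n) (h1 : σ.reg 1 = n) :
    Run V factorProg σ (5 * n + 3) fun σ' => (∀ r < 10, r ≠ 2 → σ'.reg r = σ.reg r) ∧
      σ'.mem = σ.mem ∧ σ'.reg 2 = n.minFac := by
  refine Run.mono (N := 1 + (1 + ((n - 1) * (((2 + 1) + 1) + 1) + 1))) ?_ (by omega)
    (fun _ h => h)
  refine .asg_seq (by rfl) (by omega) (by simp [h1]; omega) ?_
  refine .asg_seq (by rfl) (by omega) (by simp [h1]; omega) ?_
  -- The trial divisors run from `n` down to 2, the divisor being the counter plus 1. Variable 2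
  -- always holds a divisor of `n`, not 1 unless `n = 1`, that is at most every divisor already
  -- tried; at the end it is the least.
  refine Run.mono (Run.loop (r := 10) (I := fun k σ' => k + 1 ≤ n ∧
    (∀ r < 10, r ≠ 2 → σ'.reg r = σ.reg r) ∧ σ'.mem = σ.mem ∧ σ'.reg 2 ∣ n ∧
    (n = 1 ∨ σ'.reg 2 ≠ 1) ∧ ∀ d, d ∣ n → k + 2 ≤ d → σ'.reg 2 ≤ d) (by omega) ?_ (n - 1) _ ?_
    (by simp [h1])) le_rfl ?_
  · rintro k σ' ⟨hk, hreg, hmem, h2, h3, h4⟩ hc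
    have h1' := (hreg 1 (by omega) (by omega)).trans h1
    have hmod : n - n / (k + 2) * (k + 2) = n % (k + 2) := by
      have := Nat.div_add_mod' n (k + 2)
      omega
    have hval : (Ex.const 1 - (.var 1 - .var 1 / (.var 10 + .const 1) *
        (.var 10 + .const 1))).val σ' = 1 - n % (k + 2) := by
      simp only [Ex.val_sub, Ex.val_const, Ex.val_var, Ex.val_div, Ex.val_mul, Ex.val_add, h1', hc,
        ← hmod]
    refine Run.mono (N := (2 + 1) + 1) ?_ le_rfl (fun _ h => h)
    refine Run.seq (Q := fun σ'' => σ''.reg 10 = k + 1 ∧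
      (∀ r < 10, r ≠ 2 → σ''.reg r = σ.reg r) ∧ σ''.mem = σ.mem ∧ σ''.reg 2 ∣ n ∧
      (n = 1 ∨ σ''.reg 2 ≠ 1) ∧ ∀ d, d ∣ n → k + 2 ≤ d → σ''.reg 2 ≤ d)
      (Run.ite (N := 1) (by rfl) (fun h => ?_) (fun h => ?_)) ?_
    · rw [hval] at h
      have hd : k + 2 ∣ n := Nat.dvd_of_mod_eq_zero (by omega)
      refine .asg (by rfl) (by omega) (by simp [hc]; omega) ⟨by simp [hc], fun r hr hr2 => ?_,
        hmem, ?_, ?_, ?_⟩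
      · rw [State.setReg_reg, if_neg hr2, hreg r hr hr2]
      · simpa [hc] using hd
      · simp [hc]
      · intro d _ hd
        simp [hc]; omega
    · rw [hval] at h
      refine .skip ⟨hc, hreg, hmem, h2, h3, fun d hd hkd => h4 d hd ?_⟩
      rcases hkd.eq_or_lt with rfl | hkd
      · rw [Nat.mod_eq_zero_of_dvd hd] at h; omega
      · exact hkd
    · rintro σ'' ⟨k1, k2, k3, k4, k5, k6⟩
      refine Run.decr (k := k) (by omega) (by omega) k1 ⟨by simp, by omega, fun r hr hr2 => ?_,
        k3, by simpa using k4, by simpa using k5, by simpa using k6⟩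
      rw [State.setReg_reg, if_neg (by omega), k2 r hr hr2]
  · refine ⟨by omega, fun r hr hr2 => ?_, rfl, by simp [h1], ?_, ?_⟩
    · rw [State.setReg_reg, if_neg (by omega), State.setReg_reg, if_neg hr2]
    · simp [h1]; omega
    · intro d hd hd2
      have := Nat.le_of_dvd hn hd
      omega
  · rintro σ' ⟨-, -, h2, h3, h4, h5, h6⟩
    refine ⟨h2, h3, ?_⟩
    rcases eq_or_ne n 1 with hn1 | hn1
    · rw [hn1] at h4 ⊢
      simpa using h4
    · have h7 := Nat.minFac_prime hn1
      have h8 : σ'.reg 2 ≠ 0 := fun h => by rw [h, zero_dvd_iff] at h4; omega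
      exact le_antisymm (h6 _ n.minFac_dvd h7.two_le)
        (Nat.minFac_le_of_dvd (by omega) h4)

theorem run_length (hV : n + 8 < V) (hV3 : n ^ n < V) (hn : 0 < n) (h1 : σ.reg 1 = n)
    (h2 : σ.reg 2 = n.minFac) :
    Run V lengthProg σ (7 * n + 5) fun σ' => (∀ r < 10, r ∉ ({3, 4, 5} : Set ℕ) →
      σ'.reg r = σ.reg r) ∧ σ'.mem = σ.mem ∧ ∃ m ≤ n, σ'.reg 5 = m ∧ σ'.reg 4 = n ^ m ∧
        n ≤ n.minFac ^ m * n.minFac ^ m ∧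
        (m = 0 ∨ n.minFac ^ (m - 1) * n.minFac ^ (m - 1) < n) := by
  have hp : n.minFac ≤ n := Nat.minFac_le hn
  have hpow : ∀ m ≤ n, n ^ m < V := fun m hm =>
    (Nat.pow_le_pow_right hn hm).trans_lt hV3
  have hpow' : ∀ m ≤ n, n.minFac ^ m < V := fun m hm =>
    (Nat.pow_le_pow_left hp m).trans_lt (hpow m hm)
  refine Run.mono (N := 1 + (1 + (1 + (1 + (n * (((2 + (1 + (1 + 1))) + 1) + 1) + 1))))) ?_
    (by omega) (fun _ h => h)
  refine .asg_seq (by rfl) (by omega) (by simp; omega) ?_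
  refine .asg_seq (by rfl) (by omega) (by simp; omega) ?_
  refine .asg_seq (by rfl) (by omega) (by simp; omega) ?_
  refine .asg_seq (by rfl) (by omega) (by simp [h1]; omega) ?_
  -- Either every round so far has increased `m`, or `m` is already large enough and later rounds
  -- are idle. The last clause records that `m - 1` was too small.
  refine Run.mono (Run.loop (r := 10) (I := fun k σ' => k ≤ n ∧
    (∀ r < 10, r ∉ ({3, 4, 5} : Set ℕ) → σ'.reg r = σ.reg r) ∧ σ'.mem = σ.mem ∧ ∃ m ≤ n - k,
    σ'.reg 5 = m ∧ σ'.reg 4 = n ^ m ∧ σ'.reg 3 = n.minFac ^ m ∧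
    (m = n - k ∨ n ≤ n.minFac ^ m * n.minFac ^ m) ∧
    (m = 0 ∨ n.minFac ^ (m - 1) * n.minFac ^ (m - 1) < n)) (by omega) ?_ n _ ?_
    (by simp [h1])) le_rfl ?_
  · rintro k σ' ⟨hk, hreg, hmem, m, hm, r5, r4, r3, hor, hlt⟩ hc
    have h1' := (hreg 1 (by omega) (by simp)).trans h1
    have h2' := (hreg 2 (by omega) (by simp)).trans h2
    refine Run.mono (N := (2 + (1 + (1 + 1))) + 1) ?_ le_rfl (fun _ h => h)
    refine Run.seq (Q := fun σ'' => σ''.reg 10 = k + 1 ∧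
      (∀ r < 10, r ∉ ({3, 4, 5} : Set ℕ) → σ''.reg r = σ.reg r) ∧ σ''.mem = σ.mem ∧ ∃ m ≤ n - k,
      σ''.reg 5 = m ∧ σ''.reg 4 = n ^ m ∧ σ''.reg 3 = n.minFac ^ m ∧
      (m = n - k ∨ n ≤ n.minFac ^ m * n.minFac ^ m) ∧
      (m = 0 ∨ n.minFac ^ (m - 1) * n.minFac ^ (m - 1) < n))
      (Run.ite (N := 1 + (1 + 1)) (by rfl) (fun h => ?_) (fun h => ?_)) ?_
    · simp only [Ex.val_sub, Ex.val_var, Ex.val_mul, h1', r3] at h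
      have h4 := hpow (m + 1) (by omega)
      have h3 := hpow' (m + 1) (by omega)
      rw [pow_succ] at h3 h4
      refine .asg_seq (by rfl) (by omega) (by simpa [r3, h2'] using h3) ?_
      refine .asg_seq (by rfl) (by omega) (by simpa [r4, h1'] using h4) ?_
      refine .asg (by rfl) (by omega) (by simp [r5]; omega) ⟨by simp [hc], fun r hr hr2 => ?_,
        hmem, m + 1, by omega, by simp [r5], by simp [r4, h1', pow_succ],
        by simp [r3, h2', pow_succ], ?_, .inr ?_⟩
      · have hr3 := hr2
        simp only [Set.mem_insert_iff, Set.mem_singleton_iff, not_or] at hr3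
        simp [hr3, hreg r hr hr2]
      · left; omega
      · rw [Nat.add_sub_cancel]; omega
    · simp only [Ex.val_sub, Ex.val_var, Ex.val_mul, h1', r3] at h
      exact Run.mono (.skip ⟨hc, hreg, hmem, m, by omega, r5, r4, r3, .inr (by omega), hlt⟩)
        (by omega) (fun _ h => h)
    · rintro σ'' ⟨k1, k2, k3, m, hm, r5, r4, r3, hor⟩
      refine Run.decr (k := k) (by omega) (by omega) k1 ⟨by simp, by omega, fun r hr hr2 => ?_,
        k3, m, hm, by simpa using r5, by simpa using r4, by simpa using r3, hor⟩
      rw [State.setReg_reg, if_neg (by omega), k2 r hr hr2]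
  · refine ⟨le_rfl, fun r hr hr2 => ?_, rfl, 0, by omega, by simp, by simp, by simp, by simp,
      by simp⟩
    simp only [Set.mem_insert_iff, Set.mem_singleton_iff, not_or] at hr2
    simp [hr2, hr.ne]
  · rintro σ' ⟨-, -, h3, h4, m, hm, r5, r4, -, h5, h6⟩
    refine ⟨h3, h4, m, by omega, r5, r4, ?_, h6⟩
    rcases h5 with h5 | h5
    · rcases eq_or_ne n 1 with hn1 | hn1
      · simp [hn1]
      -- Even if no round was idle, `m = n` is large enough.
      · have h7 : n < n.minFac ^ n := Nat.lt_pow_self (Nat.minFac_prime hn1).one_lt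
        rw [Nat.sub_zero] at h5
        rw [h5]
        nlinarith
    · exact h5

end Parameters


open ListClosure

/-! ## Input, correctness and running time -/

section Words

variable {n : ℕ} {R S : Type}

theorem length_opTable (e : R ≃ Fin n) (op : R → R → R) : (opTable e op).length = n * n := by
  simp [opTable]

theorem getD_opTable (e : R ≃ Fin n) (op : R → R → R) (a b : R) :
    (opTable e op).getD (e a * n + e b) 0 = e (op a b) := by
  have ha := (e a).2
  have hb := (e b).2
  have hn : 0 < n := by omega
  have h : (e a : ℕ) * n + e b < n * n := by nlinarith
  rw [List.getD_eq_getElem _ _ (by rw [length_opTable]; exact h)]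
  have h1 : (⟨e a * n + e b, h⟩ : Fin (n * n)).divNat = e a := by
    ext
    simp only [Fin.coe_divNat]
    rw [mul_comm, Nat.mul_add_div hn, Nat.div_eq_of_lt hb, add_zero]
  have h2 : (⟨e a * n + e b, h⟩ : Fin (n * n)).modNat = e b := by
    ext
    simp only [Fin.coe_modNat]
    rw [mul_comm, Nat.mul_add_mod, Nat.mod_eq_of_lt hb]
  simp [opTable, h1, h2]

variable [NonUnitalRing R] [NonUnitalRing S] (eR : R ≃ Fin n) (eS : S ≃ Fin n)

theorem length_ringPairInput : (ringPairInput eR eS).length = base n := by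
  simp only [ringPairInput, List.length_cons, List.length_append, length_opTable, base]
  ring

theorem ringPairInput_lt {V : ℕ} (hV : n + 8 < V) (x : ℕ) : (ringPairInput eR eS).getD x 0 < V := by
  have h : ∀ y ∈ ringPairInput eR eS, y < V := by
    intro y hy
    simp only [ringPairInput, opTable, List.mem_cons, List.mem_append, List.mem_ofFn] at hy
    rcases hy with rfl | ((⟨i, rfl⟩ | ⟨i, rfl⟩) | ⟨i, rfl⟩) | ⟨i, rfl⟩
    · omega
    all_goals exact (Fin.is_lt _).trans (by omega)
  by_cases hx : x < (ringPairInput eR eS).length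
  · rw [List.getD_eq_getElem _ _ hx]
    exact h _ (List.getElem_mem hx)
  · rw [List.getD_eq_default _ _ (by omega)]
    omega

theorem getD_ringPairInput_fst (a b : R) :
    (ringPairInput eR eS).getD (1 + 0 * n * n + (eR a * n + eR b)) 0 = eR (a + b) ∧
    (ringPairInput eR eS).getD (1 + (0 + 1) * n * n + (eR a * n + eR b)) 0 = eR (a * b) := by
  have ha := (eR a).2
  have hb := (eR b).2
  have h : (eR a : ℕ) * n + eR b < n * n := by nlinarith
  constructor
  · rw [show 1 + 0 * n * n + (eR a * n + eR b) = (eR a * n + eR b) + 1 by ring, ringPairInput,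
      List.getD_cons_succ, List.getD_append _ _ _ _ (by simp [length_opTable]; omega),
      List.getD_append _ _ _ _ (by simp [length_opTable]; omega),
      List.getD_append _ _ _ _ (by simp [length_opTable]; omega)]
    exact getD_opTable eR (· + ·) a b
  · rw [show 1 + (0 + 1) * n * n + (eR a * n + eR b) = (n * n + (eR a * n + eR b)) + 1 by ring,
      ringPairInput, List.getD_cons_succ,
      List.getD_append _ _ _ _ (by simp [length_opTable]; omega),
      List.getD_append _ _ _ _ (by simp [length_opTable]; omega),
      List.getD_append_right _ _ _ _ (by simp [length_opTable]), length_opTable,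
      Nat.add_sub_cancel_left]
    exact getD_opTable eR (· * ·) a b

theorem getD_ringPairInput_snd (a b : S) :
    (ringPairInput eR eS).getD (1 + 2 * n * n + (eS a * n + eS b)) 0 = eS (a + b) ∧
    (ringPairInput eR eS).getD (1 + (2 + 1) * n * n + (eS a * n + eS b)) 0 = eS (a * b) := by
  have ha := (eS a).2
  have hb := (eS b).2
  have h : (eS a : ℕ) * n + eS b < n * n := by nlinarith
  constructor
  · rw [show 1 + 2 * n * n + (eS a * n + eS b) = (n * n + n * n + (eS a * n + eS b)) + 1 by ring,
      ringPairInput, List.getD_cons_succ,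
      List.getD_append _ _ _ _ (by simp [length_opTable]; omega),
      List.getD_append_right _ _ _ _ (by simp [length_opTable]), List.length_append,
      length_opTable, length_opTable, Nat.add_sub_cancel_left]
    exact getD_opTable eS (· + ·) a b
  · rw [show 1 + (2 + 1) * n * n + (eS a * n + eS b) =
      (n * n + n * n + n * n + (eS a * n + eS b)) + 1 by ring,
      ringPairInput, List.getD_cons_succ,
      List.getD_append_right _ _ _ _ (by simp [length_opTable]; omega), List.length_append,
      List.length_append, length_opTable, length_opTable, length_opTable, Nat.add_sub_cancel_left]
    exact getD_opTable eS (· * ·) a b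

end Words

/-- A bound on all numbers that occur. -/
def numberBound (n : ℕ) : ℕ := (n + 8) ^ (2 * (n * n) + 8)

theorem lt_numberBound (n : ℕ) : n + 8 < numberBound n ∧ (n + 1) ^ (2 * (n * n)) ≤ numberBound n ∧
    base n < numberBound n ∧ n ^ n < numberBound n := by
  refine ⟨?_, ?_, ?_, ?_⟩
  · calc n + 8 = (n + 8) ^ 1 := (pow_one _).symm
      _ < _ := Nat.pow_lt_pow_right (by omega) (by omega)
  · exact (Nat.pow_le_pow_left (by omega) _).trans (Nat.pow_le_pow_right (by omega) (by omega))
  · calc base n < (n + 8) ^ 2 * 8 := by unfold base; nlinarith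
      _ ≤ (n + 8) ^ 2 * (n + 8) := Nat.mul_le_mul_left _ (by omega)
      _ = (n + 8) ^ 3 := by ring
      _ ≤ _ := Nat.pow_le_pow_right (by omega) (by omega)
  · calc n ^ n ≤ (n + 8) ^ n := Nat.pow_le_pow_left (by omega) _
      _ < _ := Nat.pow_lt_pow_right (by omega) (by nlinarith)

/-- The numbers are huge, but their lengths are polynomial in `n`; hence so is the cost of each
operation. -/
theorem size_numberBound_le {n : ℕ} (hn : 2 ≤ n) : (numberBound n).size ≤ 20 * n ^ 3 := by
  have h1 : (n + 8).size ≤ n + 8 := Nat.size_le.2 Nat.lt_two_pow_self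
  calc (numberBound n).size ≤ (2 * (n * n) + 8) * (n + 8).size := size_pow_le _ _ (by omega)
    _ ≤ (2 * (n * n) + 8) * (n + 8) := Nat.mul_le_mul_left _ h1
    _ ≤ (2 * (n * n) + 2 * (n * n)) * (n + 4 * n) := by gcongr <;> nlinarith
    _ = 20 * n ^ 3 := by ring

variable {n : ℕ} {R S : Type} [NonUnitalRing R] [NonUnitalRing S]

/-- The number of digits is determined by its defining inequalities. -/
theorem eq_of_length_bounds {n m m' : ℕ} (h : n ≤ n.minFac ^ m * n.minFac ^ m)
    (hlt : m = 0 ∨ n.minFac ^ (m - 1) * n.minFac ^ (m - 1) < n)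
    (h' : n ≤ n.minFac ^ m' * n.minFac ^ m')
    (hlt' : m' = 0 ∨ n.minFac ^ (m' - 1) * n.minFac ^ (m' - 1) < n) : m = m' := by
  have key : ∀ a b, n ≤ n.minFac ^ a * n.minFac ^ a →
      (b = 0 ∨ n.minFac ^ (b - 1) * n.minFac ^ (b - 1) < n) → b ≤ a := by
    intro a b ha hb
    by_contra hab
    have h1 : n.minFac ^ a ≤ n.minFac ^ (b - 1) :=
      Nat.pow_le_pow_right n.minFac_pos (by omega)
    have := Nat.mul_le_mul h1 h1
    omega
  exact le_antisymm (key _ _ h' hlt) (key _ _ h hlt')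

/-- The time bound of the whole run involves `m` and must be stated before the run. The value
computed by the program is identified with this one afterwards, by uniqueness. -/
theorem exists_length_bounds {n : ℕ} (hn : 0 < n) :
    ∃ m ≤ n, n ≤ n.minFac ^ m * n.minFac ^ m ∧
      (m = 0 ∨ n.minFac ^ (m - 1) * n.minFac ^ (m - 1) < n) := by
  have hex : n ≤ n.minFac ^ n * n.minFac ^ n := by
    rcases eq_or_ne n 1 with rfl | hn1
    · simp
    · have : n < n.minFac ^ n := Nat.lt_pow_self (Nat.minFac_prime hn1).one_lt
      nlinarith
  have hex' : ∃ m, n ≤ n.minFac ^ m * n.minFac ^ m := ⟨n, hex⟩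
  classical
  refine ⟨Nat.find hex', Nat.find_min' hex' hex, Nat.find_spec hex', ?_⟩
  rcases Nat.eq_zero_or_pos (Nat.find hex') with h | h
  · exact .inl h
  · exact .inr (not_le.1 (Nat.find_min hex' (show Nat.find hex' - 1 < _ by omega)))

theorem run_isoProg (eR : R ≃ Fin n) (eS : S ≃ Fin n) :
    ∃ m ≤ n, (m = 0 ∨ n.minFac ^ (m - 1) * n.minFac ^ (m - 1) < n) ∧
      Run (numberBound n) isoProg (init (ringPairInput eR eS))
        (12 * n + 14 + 2 * (n ^ m * tupleTime n m)) fun σ =>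
        (σ.reg 0 = 0 ∨ σ.reg 0 = 1) ∧ (σ.reg 0 = 1 ↔ Nonempty (R ≃+* S)) := by
  classical
  have hn : 0 < n := (eR 0).pos
  obtain ⟨hV, hV', hVb, hVn⟩ := lt_numberBound n
  obtain ⟨m, hm, hle, hlt⟩ := exists_length_bounds hn
  refine ⟨m, hm, hlt, ?_⟩
  set V := numberBound n
  have hNV : n ^ m < V := (Nat.pow_le_pow_right hn hm).trans_lt hVn
  have hV2 : n * n < V := by unfold base at hVb; nlinarith
  refine Run.mono (N := 1 + (1 + ((5 * n + 3) + ((7 * n + 5) + ((n ^ m * tupleTime n m + 2) +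
    (n ^ m * tupleTime n m + 2)))))) ?_ (by omega) (fun _ h => h)
  have hv1 : (Ex.load (.const 0)).val (init (ringPairInput eR eS)) = n := by
    simp [init, ringPairInput]
  refine .asg_seq (by rfl) (by omega) (by omega) ?_
  rw [hv1]
  have hv6 : (Ex.const 4 * .var 1 * .var 1 + .const 1).val
      ((init (ringPairInput eR eS)).setReg 1 n) = base n := by
    simp [base]
  refine .asg_seq (by rfl) (by omega) (by omega) ?_
  rw [hv6]
  refine Run.seq (run_factor hV hn (by simp)) ?_
  rintro σ₁ ⟨hreg₁, hmem₁, h2⟩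
  refine Run.seq (run_length hV hVn hn ((hreg₁ 1 (by omega) (by omega)).trans (by simp)) h2) ?_
  rintro σ₂ ⟨hreg₂, hmem₂, m', -, h5, h4, hle', hlt'⟩
  obtain rfl := eq_of_length_bounds hle hlt hle' hlt'
  have hmem : ∀ x, σ₂.mem x = (ringPairInput eR eS).getD x 0 := by
    intro x; rw [hmem₂, hmem₁]; rfl
  have hreg : ∀ r < 10, r ≠ 2 → r ∉ ({3, 4, 5} : Set ℕ) → σ₂.reg r =
      (((init (ringPairInput eR eS)).setReg 1 n).setReg 6 (base n)).reg r :=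
    fun r hr hr2 hr3 => (hreg₂ r hr hr3).trans (hreg₁ r hr hr2)
  have hr1 : σ₂.reg 1 = n := (hreg 1 (by omega) (by omega) (by simp)).trans (by simp)
  have hr6 : σ₂.reg 6 = base n := (hreg 6 (by omega) (by omega) (by simp)).trans (by simp)
  have hIR : Input eR 0 σ₂ := ⟨by omega, hr1, hr6,
    fun a b => (hmem _).trans (getD_ringPairInput_fst eR eS a b).1,
    fun a b => (hmem _).trans (getD_ringPairInput_fst eR eS a b).2⟩
  have hIS : Input eS 2 σ₂ := ⟨le_rfl, hr1, hr6,
    fun a b => (hmem _).trans (getD_ringPairInput_snd eR eS a b).1,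
    fun a b => (hmem _).trans (getD_ringPairInput_snd eR eS a b).2⟩
  refine Run.seq (run_mark hV hV' hV2 hIR h5 (by omega) h4 hNV fun c => ?_) ?_
  -- The region of the marks lies beyond the input word, where memory is initially 0.
  · rw [hmem, List.getD_eq_default _ _ (by rw [length_ringPairInput]; omega)]
  rintro σ₃ ⟨hreg₃, hmem₃, hmark⟩
  have hIS' : Input eS 2 σ₃ := hIS.of_eq (hreg₃ 1 (by omega)) (hreg₃ 6 (by omega)) hmem₃
  refine Run.mono (run_search hV hV' hV2 hIS' ((hreg₃ 5 (by omega)).trans h5) (by omega)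
    ((hreg₃ 4 (by omega)).trans h4) hNV ?_) le_rfl ?_
  · rw [hreg₃ 0 (by omega), hreg 0 (by omega) (by omega) (by simp)]
    simp [init]
  rintro σ₄ ⟨h01, hans⟩
  refine ⟨h01, ?_⟩
  rw [hans, nonempty_ringEquiv_iff_collision hn (by rw [Nat.card_congr eR, Nat.card_fin])
    (by rw [Nat.card_congr eS, Nat.card_fin]) hle (chooses_firstMissing eR)
    (chooses_firstMissing eS) (exists_numbered eR) (exists_numbered eS)]
  constructor
  · rintro ⟨U, hU, h6, h7⟩
    obtain ⟨T, hT, h8, h9⟩ := (hmark _).1 h7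
    exact ⟨T, hT, U, hU, h8, h6, h9⟩
  · rintro ⟨T, hT, U, hU, h8, h6, h9⟩
    exact ⟨U, hU, h6, (hmark _).2 ⟨T, hT, h8, h9⟩⟩

/-- The time bound, for orders at least two. -/
theorem total_le {n m : ℕ} (hn : 2 ≤ n) (hm : m ≤ n) :
    (12 * n + 14 + 2 * (n ^ m * tupleTime n m)) * (200 * (numberBound n).size) ≤
      n ^ (m + 27) := by
  have h1 : tupleTime n m ≤ 120 * n ^ 2 := by
    have : m * (39 * n + 15) ≤ n * (39 * n + 15) := Nat.mul_le_mul_right _ hm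
    unfold tupleTime
    nlinarith
  have h2 : 1 ≤ n ^ m := Nat.one_le_pow _ _ (by omega)
  have h3 : 12 * n + 14 ≤ 10 * n ^ 2 := by nlinarith
  have h4 : 12 * n + 14 + 2 * (n ^ m * tupleTime n m) ≤ 250 * (n ^ m * n ^ 2) := by
    have h5 : n ^ m * tupleTime n m ≤ n ^ m * (120 * n ^ 2) := Nat.mul_le_mul_left _ h1
    have h6 : 1 * n ^ 2 ≤ n ^ m * n ^ 2 := Nat.mul_le_mul_right _ h2
    nlinarith
  calc _ ≤ 250 * (n ^ m * n ^ 2) * (200 * (20 * n ^ 3)) :=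
        Nat.mul_le_mul h4 (Nat.mul_le_mul_left _ (size_numberBound_le hn))
    _ = 1000000 * n ^ (m + 5) := by ring
    -- The numerical constant is absorbed into a power of `n`, which is possible because `n ≥ 2`;
    -- the exponent 27 is 22 + 5.
    _ ≤ 2 ^ 22 * n ^ (m + 5) := Nat.mul_le_mul_right _ (by norm_num)
    _ ≤ n ^ 22 * n ^ (m + 5) := Nat.mul_le_mul_right _ (Nat.pow_le_pow_left hn _)
    _ = _ := by ring

/-- By minimality of `m`, `p ^ (2 * (m - 1)) < n` for positive `m`; taking logarithms loses one unit
through rounding up. -/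
theorem le_half_logb {n m : ℕ} (hn : 2 ≤ n)
    (h : m = 0 ∨ n.minFac ^ (m - 1) * n.minFac ^ (m - 1) < n) :
    (m : ℝ) ≤ (1 / 2 : ℝ) * Real.logb n.minFac n + 1 := by
  have hp := (Nat.minFac_prime (show n ≠ 1 by omega)).one_lt
  have hp' : (1 : ℝ) < n.minFac := by exact_mod_cast hp
  have hn' : (1 : ℝ) ≤ n := by exact_mod_cast (by omega : 1 ≤ n)
  rcases Nat.eq_zero_or_pos m with rfl | hm
  · have := Real.logb_nonneg hp' hn'
    push_cast
    linarith
  · have h1 := h.resolve_left (by omega)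
    rw [← pow_add] at h1
    have h2 : ((m - 1 + (m - 1) : ℕ) : ℝ) ≤ Real.logb n.minFac n := by
      rw [Real.le_logb_iff_rpow_le hp' (by linarith), Real.rpow_natCast]
      exact_mod_cast h1.le
    rw [Nat.cast_add, Nat.cast_sub hm] at h2
    push_cast at h2
    linarith

end RAM

theorem mainTheorem4 :
    ∃ (P : RAM.Prog) (c : ℝ),
      ∀ (n : ℕ) (R S : Type) [NonUnitalRing R] [NonUnitalRing S]
        (eR : R ≃ Fin n) (eS : S ≃ Fin n),
        ∃ (t : ℕ) (s : RAM.State),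
          RAM.Exec P (RAM.init (ringPairInput eR eS)) t s ∧
          (Nonempty (R ≃+* S) → s.reg 0 = 1) ∧
          (¬ Nonempty (R ≃+* S) → s.reg 0 = 0) ∧
          ∀ p : ℕ, IsLeast {q : ℕ | q.Prime ∧ q ∣ n} p →
            (t : ℝ) ≤ (n : ℝ) ^ ((1 / 2 : ℝ) * Real.logb (p : ℝ) (n : ℝ) + c) := by
  -- The constant 28 is the 27 of `total_le` plus the 1 of `le_half_logb`.
  refine ⟨RAM.isoProg, 28, fun n R S _ _ eR eS => ?_⟩
  obtain ⟨m, hm, hlt, hrun⟩ := RAM.run_isoProg eR eS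
  have hV := (RAM.lt_numberBound n).1
  obtain ⟨t, s, σ, h1, h2, h3, -, h4, h5⟩ := hrun
    ⟨by omega, fun r _ => by simp only [RAM.init]; omega, RAM.ringPairInput_lt eR eS hV⟩ _
    ⟨fun _ _ => rfl, rfl⟩
  have h0 := h2.1 0 (by omega)
  refine ⟨t, s, h1, fun h => by rw [h0, h5.2 h], fun h => ?_, fun p hp => ?_⟩
  · rw [h0]
    exact h4.resolve_right fun h' => h (h5.1 h')
  · have hn0 : 0 < n := (eR 0).pos
    -- The existence of a prime divisor excludes `n = 1`, so the time bound is only claimed from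
    -- order 2 on.
    have hn : 2 ≤ n := hp.1.1.two_le.trans (Nat.le_of_dvd hn0 hp.1.2)
    have hpn : p = n.minFac := le_antisymm
      (hp.2 ⟨Nat.minFac_prime (by omega), n.minFac_dvd⟩)
      (Nat.minFac_le_of_dvd hp.1.1.two_le hp.1.2)
    have hle : (t : ℝ) ≤ (n : ℝ) ^ (m + 27) := by
      exact_mod_cast h3.trans (RAM.total_le hn hm)
    have hmle := RAM.le_half_logb hn hlt
    rw [← hpn] at hmle
    refine hle.trans ?_
    rw [← Real.rpow_natCast]
    refine Real.rpow_le_rpow_of_exponent_le (by exact_mod_cast hn0) ?_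
    push_cast
    linarith
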